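/- Let $T=(V,E)$ be a perfect ternary tree of height $h\ge 4$ with root $r$ (a rooted tree in which every non-leaf node has exactly three children and all leaves are at graph distance $h$ from $r$), with unit edge weights, $n=|V|$ nodes and graph distance $d$. For a nonempty set $S\subseteq V$ of leaders let $L_{ff}$ be the principal submatrix of the graph Laplacian of $T$ indexed by the followers $V\setminus S$, and consider the noise-free leader dynamics $$\dot x_i=-x_i\quad(i\in S),\qquad \dot x_i=-\sum_{j\sim i}(x_i-x_j)+\xi_i\quad(i\in V\setminus S),$$ where the $\xi_i$ are uncorrelated zero-mean white noises of unit intensity and the initial state is square-integrable. The coherence of $S$ is the total steady-state variance of the followers, $$R_{NF}(S)=\lim_{t\to\infty}\sum_{i\in V\setminus S}\mathbf E[x_i(t)^2]=\tfrac12\operatorname{tr}(L_{ff}^{-1}),$$ where $L_{ff}$ is invertible and the second equality holds for every solution of the dynamics. The noise-free 2-leader selection problem is to minimize $R_{NF}(S)$ over all nonempty $S\subseteq V$ with $|S|\le 2$. Then the minimum is attained, and $S$ is a minimizer if and only if $S=\{x,y\}$ with $d_{xy}=2$ and $d_{xr}=d_{yr}=1$, that is, $x$ and $y$ are two distinct children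 of the root. For each minimizer $S$, $$R_{NF}(S)=\frac{2n+1}{4}\bigl(\log_3(2n+1)-2\bigr)+1 .$$ -/

import Mathlib

open MeasureTheory Filter Topology

/-! ### Perfect `M`-ary trees -/

/-- The children of `v` in the tree `G` rooted at `r`: the neighbours of `v` lying one level
further away from the root. The level of a node is its graph distance to `r`. -/
def treeChildren {V : Type*} (G : SimpleGraph V) (r v : V) : Set V :=
  {w | G.Adj v w ∧ G.dist r w = G.dist r v + 1}

/-- `G`, rooted at `r`, is a perfect `M`-ary tree of height `h`: every node that is not a leaf
has exactly `M` children, and all leaves (nodes without children) are at level `h`. -/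
structure IsPerfectTree {V : Type*} (M : ℕ) (G : SimpleGraph V) (r : V) (h : ℕ) : Prop where
  isTree : G.IsTree
  ncard_children : ∀ v, (treeChildren G r v).Nonempty → (treeChildren G r v).ncard = M
  level_leaf : ∀ v, treeChildren G r v = ∅ → G.dist r v = h

/-! ### Noise-free leader dynamics -/

/-- The family `W i`, `i : ι`, consists of integrals over time of mutually uncorrelated zero-mean
white noises of unit intensity (in the second-order sense): the paths are continuous,
`E[W i t] = 0` and `E[W i s * W j t]` is `min s t` if `i = j` and `0` otherwise.
Independent standard Brownian motions with continuous paths are an example. -/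
structure IsIntegratedWhiteNoise {Ω : Type*} [MeasurableSpace Ω] (P : Measure Ω)
    {ι : Type*} [DecidableEq ι] (W : ι → ℝ → Ω → ℝ) : Prop where
  measurable : ∀ i t, 0 ≤ t → Measurable (W i t)
  continuousOn : ∀ i ω, ContinuousOn (fun t => W i t ω) (Set.Ici 0)
  memLp : ∀ i t, 0 ≤ t → MemLp (W i t) 2 P
  mean : ∀ i t, 0 ≤ t → ∫ ω, W i t ω ∂P = 0
  covariance : ∀ i j s t, 0 ≤ s → 0 ≤ t →
    ∫ ω, W i s ω * W j t ω ∂P = if i = j then min s t else 0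

/-- `X` solves the consensus dynamics on the graph `G` (unit edge weights) with the set `S` of
noise-free leaders (unit degrees of stubbornness, external signal `0`):
leaders follow `dx_i = - x_i dt`, followers follow
`dx_i = - ∑_{j ∈ N(i)} (x_i - x_j) dt + dW_i`, with `W` an integrated white noise,
both in integral form. The initial state is any square-integrable random vector. -/
structure IsNoiseFreeLeaderProcess {V : Type*} [Fintype V] [DecidableEq V]
    (G : SimpleGraph V) [DecidableRel G.Adj] (S : Finset V)
    {Ω : Type*} [MeasurableSpace Ω] (P : Measure Ω)
    (W : {i : V // i ∉ S} → ℝ → Ω → ℝ) (X : V → ℝ → Ω → ℝ) : Prop where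
  noise : IsIntegratedWhiteNoise P W
  measurable : ∀ i t, 0 ≤ t → Measurable (X i t)
  continuousOn : ∀ i ω, ContinuousOn (fun t => X i t ω) (Set.Ici 0)
  initial : ∀ i, MemLp (X i 0) 2 P
  leader : ∀ i ∈ S, ∀ t, 0 ≤ t → ∀ ω,
    X i t ω = X i 0 ω + ∫ s in (0 : ℝ)..t, -X i s ω
  follower : ∀ i : {i : V // i ∉ S}, ∀ t, 0 ≤ t → ∀ ω,
    X i t ω = X i 0 ω + (∫ s in (0 : ℝ)..t, -∑ j ∈ G.neighborFinset i, (X i s ω - X j s ω))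
      + W i t ω

/-! ### Coherence and leader selection -/

/-- The principal submatrix `L_ff` of the graph Laplacian on the followers `V \ S`. -/
noncomputable def followerLaplacian {V : Type*} [Fintype V] [DecidableEq V]
    (G : SimpleGraph V) [DecidableRel G.Adj] (S : Finset V) :
    Matrix {i : V // i ∉ S} {i : V // i ∉ S} ℝ :=
  (G.lapMatrix ℝ).submatrix Subtype.val Subtype.val

/-- The coherence `R_NF(S) = (1/2) tr (L_ff⁻¹)` of a connected graph with a nonempty set `S` of
noise-free leaders. -/
noncomputable def coherenceNF {V : Type*} [Fintype V] [DecidableEq V]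
    (G : SimpleGraph V) [DecidableRel G.Adj] (S : Finset V) : ℝ :=
  (1 / 2) * ((followerLaplacian G S)⁻¹).trace

/-- `S` is an optimal solution of the noise-free `k`-leader selection problem: it minimizes the
coherence among the nonempty leader sets of size at most `k`. -/
def IsOptimalLeaderSet {V : Type*} [Fintype V] [DecidableEq V]
    (G : SimpleGraph V) [DecidableRel G.Adj] (k : ℕ) (S : Finset V) : Prop :=
  S.Nonempty ∧ S.card ≤ k ∧
    ∀ T : Finset V, T.Nonempty → T.card ≤ k → coherenceNF G S ≤ coherenceNF G T

/-! On a tree, `L_ff⁻¹` for leaders `x`, `y` is explicit: the Gromov product based at `x` (the Green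
function grounded at `x`) minus a rank-one term that grounds `y` as well (`treeGreen`). With `D =
d(x,y)`, `σ` the distance sums and `Q` the sum of the squares `(d(x,v) - d(y,v))²`, its trace turns
the coherence into `1/2 * ((σ x + σ y)/2 - n D/4 - Q/(4 D))` (`coherenceNF_pair_of_ne`).

In a perfect ternary tree, moving a vertex to a child changes `σ` and `Q` by amounts that depend
only on levels, distances and subtree sizes. Induction then expresses both through the level `c` of
the lowest common ancestor and the depths `i`, `j` below it (`exists_levels`), which leaves the
function `pairCost N c i j` with `N = 3^(h+1)/2`. At `c = 0` its excess over `(i, j) = (1, 1)`,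
times `i + j`, is `N * K` plus a term bounded below, where `K` vanishes at `(1, 1)` and is at least
`1/6` otherwise (`one_sixth_le_of_lt`); a positive `c` only adds cost (`pairCost_zero_lt`). A single
leader is never optimal, since any second leader strictly helps.

For the variance, `L_ff` is diagonalized orthogonally. The rotated noise is still white, and the
followers decouple into scalar Ornstein-Uhlenbeck equations with rates `l k` and an input from the
leaders decaying like `e^{-t}`. Their second moments tend to `1/(2 * l k)`, which add up to half the
trace of the inverse. -/

/-! ### Distances in trees -/

namespace SimpleGraph

variable {V : Type*} {G : SimpleGraph V}

/-- A vertex different from `v` has a neighbour closer to `v`. -/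
theorem Connected.exists_adj_dist_add_one (hG : G.Connected) {u v : V} (h : u ≠ v) :
    ∃ w, G.Adj u w ∧ G.dist u v = G.dist w v + 1 := by
  obtain ⟨p, hp⟩ := hG.exists_walk_length_eq_dist u v
  cases p with
  | nil => exact absurd rfl h
  | @cons _ w _ hadj q =>
    refine ⟨w, hadj, ?_⟩
    have h1 := dist_le q
    have h2 := hG.dist_triangle (u := u) (v := w) (w := v)
    have h3 := dist_eq_one_iff_adj.2 hadj
    simp only [Walk.length_cons] at hp
    omega

/-- In a tree, the neighbour closer to `v` is unique. -/
theorem IsTree.eq_of_adj_of_dist_add_one (hG : G.IsTree) {u v a b : V}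
    (ha : G.Adj u a) (hb : G.Adj u b) (hda : G.dist u v = G.dist a v + 1)
    (hdb : G.dist u v = G.dist b v + 1) : a = b := by
  obtain ⟨p, hp⟩ := hG.connected.exists_walk_length_eq_dist a v
  obtain ⟨q, hq⟩ := hG.connected.exists_walk_length_eq_dist b v
  have hp' : (Walk.cons ha p).IsPath := by
    apply Walk.isPath_of_length_eq_dist; simp [hp, hda]
  have hq' : (Walk.cons hb q).IsPath := by
    apply Walk.isPath_of_length_eq_dist; simp [hq, hdb]
  have := (hG.existsUnique_path u v).unique hp' hq'
  injection this

theorem IsTree.dist_eq_or (hG : G.IsTree) {a b : V} (hab : G.Adj a b) (u : V) :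
    G.dist a u = G.dist b u + 1 ∨ G.dist b u = G.dist a u + 1 := by
  have := hG.dist_eq_dist_add_one_of_adj u hab
  rw [dist_comm (u := u) (v := a), dist_comm (u := u) (v := b)] at this
  exact this

/-- Removing an edge `a b` of a tree separates it into the vertices closer to `a` and the
vertices closer to `b`; a geodesic between the two sides passes through the edge. -/
theorem IsTree.dist_eq_add_of_adj (hG : G.IsTree) {a b u : V} (hab : G.Adj a b)
    (hu : G.dist b u = G.dist a u + 1) {z : V} (hz : G.dist a z = G.dist b z + 1) :
    G.dist u z = G.dist u a + 1 + G.dist b z := by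
  induction hk : G.dist b z using Nat.strong_induction_on generalizing z with
  | _ k ih =>
  rcases Nat.eq_zero_or_pos k with rfl | hpos
  · have : b = z := hG.connected.dist_eq_zero_iff.1 hk
    subst this
    rw [dist_comm, hu, dist_comm]
  have step : ∀ z : V, 0 < G.dist b z → G.dist a z = G.dist b z + 1 →
      ∃ w, G.Adj z w ∧ G.dist b z = G.dist b w + 1 ∧ G.dist a w = G.dist b w + 1 := by
    intro z hz0 hz
    have hne : z ≠ b := by rintro rfl; simp at hz0
    obtain ⟨w, hw, hd⟩ := hG.connected.exists_adj_dist_add_one hne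
    have e1 := dist_comm (G := G) (u := z) (v := b)
    have e2 := dist_comm (G := G) (u := w) (v := b)
    have e3 := dist_comm (G := G) (u := z) (v := a)
    have e4 := dist_comm (G := G) (u := w) (v := a)
    refine ⟨w, hw, by omega, ?_⟩
    have h1 := hG.dist_eq_or hw a
    have h2 := hG.dist_eq_or hab w
    omega
  obtain ⟨w, hw, hdw, haw⟩ := step z (by omega) hz
  have ihw := ih (G.dist b w) (by omega) haw rfl
  have c1 := dist_comm (G := G) (u := u) (v := w)
  have c2 := dist_comm (G := G) (u := u) (v := z)
  rcases hG.dist_eq_or hw u with h1 | h1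
  · omega
  -- Otherwise `z` is a neighbour of `w` closer to `u`. That neighbour is unique, but `a` (if `w =
  -- b`) or the next vertex towards `b` already is one.
  exfalso
  rcases Nat.eq_zero_or_pos (G.dist b w) with h0 | h0
  · have : b = w := hG.connected.dist_eq_zero_iff.1 h0
    subst this
    have := hG.eq_of_adj_of_dist_add_one hab.symm hw.symm hu h1
    subst this
    simp at hz
  · obtain ⟨x, hx, hdx, hax⟩ := step w h0 haw
    have ihx := ih (G.dist b x) (by omega) hax rfl
    have c3 := dist_comm (G := G) (u := u) (v := x)
    have := hG.eq_of_adj_of_dist_add_one hx hw.symm (v := u) (by omega) h1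
    subst this
    omega

variable [Fintype V] [DecidableEq V] [DecidableRel G.Adj]

/-- The Laplacian of the distance to a vertex of a tree. -/
theorem IsTree.sum_neighborFinset_dist (hG : G.IsTree) (u v : V) :
    ∑ w ∈ G.neighborFinset u, ((G.dist u v : ℝ) - G.dist w v) =
      2 - G.degree u - if u = v then 2 else 0 := by
  by_cases h : u = v
  · subst h
    rw [Finset.sum_congr rfl (g := fun _ => (-1 : ℝ))]
    · simp
    · intro w hw
      have : G.dist w u = 1 := dist_eq_one_iff_adj.2 ((G.mem_neighborFinset _ _).1 hw).symm
      simp [this]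
  -- Exactly one neighbour is closer to `v` and contributes `1`; every other one contributes `-1`.
  · obtain ⟨a, ha, hda⟩ := hG.connected.exists_adj_dist_add_one h
    have ha' : a ∈ G.neighborFinset u := (G.mem_neighborFinset _ _).2 ha
    rw [← Finset.add_sum_erase _ _ ha', Finset.sum_congr rfl (g := fun _ => (-1 : ℝ))]
    · have hc : 0 < G.degree u := Finset.card_pos.2 ⟨a, ha'⟩
      rw [Finset.sum_const, Finset.card_erase_of_mem ha', card_neighborFinset_eq_degree, hda,
        nsmul_eq_mul, Nat.cast_pred hc]
      simp [h]; ring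
    · intro w hw
      rw [Finset.mem_erase, mem_neighborFinset] at hw
      rcases hG.dist_eq_or hw.2 v with h1 | h1
      · exact absurd (hG.eq_of_adj_of_dist_add_one hw.2 ha h1 hda) hw.1
      · simp [h1]

end SimpleGraph

/-! ### Distance sums in perfect ternary trees -/

section PerfectTree

variable {V : Type*} [Fintype V]

/-- The sum of the distances to `x`. -/
noncomputable def distSum (G : SimpleGraph V) (x : V) : ℝ := ∑ u, (G.dist x u : ℝ)

/-- The sum of the squared differences of the distances to `x` and to `y`. -/
noncomputable def distDiffSqSum (G : SimpleGraph V) (x y : V) : ℝ :=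
  ∑ u, ((G.dist x u : ℝ) - G.dist y u) ^ 2

theorem distDiffSqSum_comm (G : SimpleGraph V) (x y : V) :
    distDiffSqSum G x y = distDiffSqSum G y x :=
  Finset.sum_congr rfl fun _ _ => by ring

open Classical in
/-- The descendants of `v` (including `v`) in the tree `G` rooted at `r`. -/
noncomputable def treeDescendants (G : SimpleGraph V) (r v : V) : Finset V :=
  {u | G.dist r u = G.dist r v + G.dist v u}

theorem mem_treeDescendants {G : SimpleGraph V} {r u v : V} :
    u ∈ treeDescendants G r v ↔ G.dist r u = G.dist r v + G.dist v u := by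
  simp [treeDescendants]

open Classical in
/-- The children of `v` as a finite set. -/
noncomputable def treeChildFinset (G : SimpleGraph V) (r v : V) : Finset V :=
  {w | G.Adj v w ∧ G.dist r w = G.dist r v + 1}

theorem mem_treeChildFinset {G : SimpleGraph V} {r v w : V} :
    w ∈ treeChildFinset G r v ↔ G.Adj v w ∧ G.dist r w = G.dist r v + 1 := by
  simp [treeChildFinset]

theorem coe_treeChildFinset (G : SimpleGraph V) (r v : V) :
    (treeChildFinset G r v : Set V) = treeChildren G r v := by
  ext w; simp [mem_treeChildFinset, treeChildren]

variable {G : SimpleGraph V} {r : V}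

theorem treeDescendants_root : treeDescendants G r r = Finset.univ := by
  ext u; simp [mem_treeDescendants]

/-- Cutting the edge from `v` to `c` leaves the subtree below `c` as the side closer to `c`. -/
theorem SimpleGraph.IsTree.mem_treeDescendants_child (hG : G.IsTree) {v c u : V}
    (hc : c ∈ treeChildFinset G r v) :
    u ∈ treeDescendants G r c ↔ G.dist v u = G.dist c u + 1 := by
  rw [mem_treeChildFinset] at hc
  rw [mem_treeDescendants]
  constructor
  · intro h
    have h1 := hG.connected.dist_triangle (u := r) (v := v) (w := u)
    have h2 := hG.dist_eq_or hc.1 u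
    omega
  · intro h
    have h1 := hG.dist_eq_add_of_adj hc.1.symm h (z := r)
      (by rw [SimpleGraph.dist_comm, hc.2, SimpleGraph.dist_comm])
    rw [SimpleGraph.dist_comm, SimpleGraph.dist_comm (u := v), SimpleGraph.dist_comm (u := u)] at h1
    omega

theorem SimpleGraph.IsTree.notMem_treeDescendants_child (hG : G.IsTree) {v c u : V}
    (hc : c ∈ treeChildFinset G r v) :
    u ∉ treeDescendants G r c ↔ G.dist c u = G.dist v u + 1 := by
  rw [hG.mem_treeDescendants_child hc]
  have := hG.dist_eq_or (mem_treeChildFinset.1 hc).1 u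
  omega

/-- A sum over the descendants of `v` splits into `v` and the subtrees of the children. -/
theorem SimpleGraph.IsTree.sum_treeDescendants (hG : G.IsTree) (v : V) (g : V → ℝ) :
    ∑ u ∈ treeDescendants G r v, g u =
      g v + ∑ c ∈ treeChildFinset G r v, ∑ u ∈ treeDescendants G r c, g u := by
  classical
  rw [← Finset.sum_biUnion, ← Finset.sum_insert]
  · congr 1
    ext u
    rw [Finset.mem_insert, Finset.mem_biUnion]
    constructor
    · intro hu
      by_cases huv : u = v
      · exact Or.inl huv
      · right
        obtain ⟨c, hc, hd⟩ := hG.connected.exists_adj_dist_add_one (Ne.symm huv)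
        rw [mem_treeDescendants] at hu
        have h1 := hG.dist_eq_or hc r
        have h2 := hG.connected.dist_triangle (u := r) (v := c) (w := u)
        have h3 := SimpleGraph.dist_comm (G := G) (u := v) (v := r)
        have h4 := SimpleGraph.dist_comm (G := G) (u := c) (v := r)
        exact ⟨c, mem_treeChildFinset.2 ⟨hc, by omega⟩, mem_treeDescendants.2 (by omega)⟩
    · rintro (rfl | ⟨c, hc, hu⟩)
      · simp [mem_treeDescendants]
      · have h1 := (hG.mem_treeDescendants_child hc).1 hu
        rw [mem_treeDescendants] at hu ⊢
        have := (mem_treeChildFinset.1 hc).2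
        omega
  · intro hv
    obtain ⟨c, hc, hu⟩ := Finset.mem_biUnion.1 hv
    have h1 := (hG.mem_treeDescendants_child hc).1 hu
    simp at h1
  · intro c hc c' hc' hne
    refine Finset.disjoint_left.2 fun u hu hu' => hne ?_
    exact hG.eq_of_adj_of_dist_add_one (mem_treeChildFinset.1 hc).1 (mem_treeChildFinset.1 hc').1
      ((hG.mem_treeDescendants_child hc).1 hu) ((hG.mem_treeDescendants_child hc').1 hu')

/-- Moving from `v` to `c` brings the descendants of `c` one step closer and all other vertices one
step farther. -/
theorem SimpleGraph.IsTree.distSum_child (hG : G.IsTree) {v c : V}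
    (hc : c ∈ treeChildFinset G r v) :
    distSum G c = distSum G v + Fintype.card V - 2 * (treeDescendants G r c).card := by
  classical
  have key : ∀ u, (G.dist c u : ℝ) =
      G.dist v u + 1 - if u ∈ treeDescendants G r c then 2 else 0 := by
    intro u
    split_ifs with h
    · rw [(hG.mem_treeDescendants_child hc).1 h]; push_cast; ring
    · rw [(hG.notMem_treeDescendants_child hc).1 h]; push_cast; ring
  simp only [distSum, key, Finset.sum_sub_distrib, Finset.sum_add_distrib, Finset.sum_ite_mem]
  simp; ring

/-- Put `a = d(v,u) - d(y,u)`. The move replaces `a` by `a - 1` below `c` and by `a + 1` elsewhere.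
Below `c` the geodesic to `y` passes through `v`, so `a = -d(v,y)` is constant there and the
correction `-4a` sums to a multiple of the subtree size. -/
theorem SimpleGraph.IsTree.distDiffSqSum_child (hG : G.IsTree) {v c y : V}
    (hc : c ∈ treeChildFinset G r v) (hy : y ∉ treeDescendants G r c) :
    distDiffSqSum G c y = distDiffSqSum G v y + 2 * (distSum G v - distSum G y) +
      4 * G.dist v y * (treeDescendants G r c).card + Fintype.card V := by
  classical
  have hy' := (hG.notMem_treeDescendants_child hc).1 hy
  have key : ∀ u, ((G.dist c u : ℝ) - G.dist y u) ^ 2 =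
      (G.dist v u - G.dist y u) ^ 2 + 2 * (G.dist v u - G.dist y u) + 1 +
        if u ∈ treeDescendants G r c then 4 * (G.dist v y : ℝ) else 0 := by
    intro u
    split_ifs with h
    · have h1 := (hG.mem_treeDescendants_child hc).1 h
      have h2 := hG.dist_eq_add_of_adj (mem_treeChildFinset.1 hc).1.symm h1 hy'
      rw [SimpleGraph.dist_comm, SimpleGraph.dist_comm (u := u)] at h2
      rw [h1, h2]; push_cast; ring
    · rw [(hG.notMem_treeDescendants_child hc).1 h]; push_cast; ring
  simp only [distDiffSqSum, distSum, key, Finset.sum_add_distrib, Finset.sum_ite_mem,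
    ← Finset.mul_sum, Finset.sum_sub_distrib]
  simp; ring

namespace IsPerfectTree

variable {h : ℕ}

theorem dist_root_le {M : ℕ} (hG : IsPerfectTree M G r h) (v : V) : G.dist r v ≤ h := by
  obtain ⟨m, -, hm⟩ := Finset.exists_max_image Finset.univ (G.dist r) ⟨v, Finset.mem_univ v⟩
  have : treeChildren G r m = ∅ := by
    ext w
    simp only [treeChildren, Set.mem_ofPred_eq, Set.mem_empty_iff_false, iff_false, not_and]
    intro _ h1
    have := hm w (Finset.mem_univ _)
    omega
  rw [← hG.level_leaf m this]
  exact hm v (Finset.mem_univ _)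

theorem card_treeChildFinset {M : ℕ} (hG : IsPerfectTree M G r h) {v : V} (hv : G.dist r v < h) :
    (treeChildFinset G r v).card = M := by
  rw [← Set.ncard_coe_finset, coe_treeChildFinset]
  apply hG.ncard_children
  rw [Set.nonempty_iff_ne_empty]
  intro he
  have := hG.level_leaf v he
  omega

theorem treeChildFinset_eq_empty {M : ℕ} (hG : IsPerfectTree M G r h) {v : V}
    (hv : G.dist r v = h) : treeChildFinset G r v = ∅ := by
  ext w
  simp only [mem_treeChildFinset, Finset.notMem_empty, iff_false, not_and]
  intro _ h1
  have := hG.dist_root_le w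
  omega

/-- Induction on the height `k` of the subtree. The two claims go together because distances from
`v` exceed those from the child by one, which adds the size of the child's subtree. -/
theorem card_and_sum_dist_treeDescendants (hG : IsPerfectTree 3 G r h) (k : ℕ) (v : V)
    (hk : G.dist r v + k = h) :
    ((treeDescendants G r v).card : ℝ) = (3 ^ (k + 1) - 1) / 2 ∧
      ∑ u ∈ treeDescendants G r v, (G.dist v u : ℝ) = ((2 * k - 1) * 3 ^ (k + 1) + 3) / 4 := by
  induction k generalizing v with
  | zero =>
    have h1 := hG.isTree.sum_treeDescendants (r := r) v (fun _ => (1 : ℝ))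
    rw [hG.isTree.sum_treeDescendants]
    rw [hG.treeChildFinset_eq_empty hk] at h1 ⊢
    simp at h1
    norm_num [h1]
  | succ k ih =>
    have h1 := hG.isTree.sum_treeDescendants (r := r) v (fun _ => (1 : ℝ))
    have h3 := hG.card_treeChildFinset (v := v) (by omega)
    have hc : ∀ c ∈ treeChildFinset G r v, G.dist r c + k = h := fun c hc => by
      have := (mem_treeChildFinset.1 hc).2
      omega
    constructor
    · simp only [Finset.sum_const, nsmul_eq_mul, mul_one] at h1
      rw [h1, Finset.sum_congr rfl fun c hc' => (ih c (hc c hc')).1]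
      simp [h3]; ring
    · rw [hG.isTree.sum_treeDescendants, Finset.sum_congr rfl
        (g := fun _ => (((2 * k - 1) * 3 ^ (k + 1) + 3) / 4 + (3 ^ (k + 1) - 1) / 2 : ℝ))]
      · simp [h3]; ring
      · intro c hc'
        rw [← (ih c (hc c hc')).2, ← (ih c (hc c hc')).1, Finset.sum_congr rfl
          (g := fun u => (G.dist c u : ℝ) + 1)]
        · simp [Finset.sum_add_distrib]
        · intro u hu
          rw [(hG.isTree.mem_treeDescendants_child hc').1 hu]; push_cast; ring

theorem card_eq (hG : IsPerfectTree 3 G r h) : (Fintype.card V : ℝ) = 3 ^ (h + 1) / 2 - 1 / 2 := by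
  have := (hG.card_and_sum_dist_treeDescendants h r (by simp)).1
  rw [treeDescendants_root, Finset.card_univ] at this
  rw [this]; ring

theorem distSum_root (hG : IsPerfectTree 3 G r h) :
    distSum G r = ((2 * h - 1) * 3 ^ (h + 1) + 3) / 4 := by
  have := (hG.card_and_sum_dist_treeDescendants h r (by simp)).2
  rwa [treeDescendants_root] at this

/-- Writing the size with a power of `1/3` in the level, rather than with the height `h - level`,
lets the later recursions close by `ring`. -/
theorem card_treeDescendants (hG : IsPerfectTree 3 G r h) (v : V) :
    ((treeDescendants G r v).card : ℝ) = 3 ^ (h + 1) / 2 * (1 / 3) ^ G.dist r v - 1 / 2 := by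
  obtain ⟨k, hk⟩ := Nat.exists_eq_add_of_le (hG.dist_root_le v)
  rw [(hG.card_and_sum_dist_treeDescendants k v hk.symm).1]
  have : (3 : ℝ) ^ (h + 1) * (1 / 3) ^ G.dist r v = 3 ^ (k + 1) := by
    rw [hk, add_assoc, pow_add, mul_right_comm, ← mul_pow]; norm_num
  linear_combination (-1 / 2) * this

/-- A vertex other than the root is a child of some vertex. -/
theorem exists_parent {M : ℕ} (hG : IsPerfectTree M G r h) {c : V} (hc : c ≠ r) :
    ∃ v, c ∈ treeChildFinset G r v := by
  obtain ⟨v, hv, hd⟩ := hG.isTree.connected.exists_adj_dist_add_one hc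
  refine ⟨v, mem_treeChildFinset.2 ⟨hv.symm, ?_⟩⟩
  rwa [SimpleGraph.dist_comm, SimpleGraph.dist_comm (u := r)]

/-- `distSum_child` telescoped along the path from the root; the subtree sizes form a geometric sum.
-/
theorem distSum_eq (hG : IsPerfectTree 3 G r h) (v : V) :
    distSum G v = distSum G r + G.dist r v * (3 ^ (h + 1) / 2 + 1 / 2) -
      3 ^ (h + 1) / 2 * (1 - (1 / 3) ^ G.dist r v) := by
  induction hk : G.dist r v generalizing v with
  | zero =>
    have : r = v := hG.isTree.connected.dist_eq_zero_iff.1 hk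
    subst this; simp
  | succ k ih =>
    obtain ⟨p, hp⟩ := hG.exists_parent (c := v) (by rintro rfl; simp at hk)
    have hpd := (mem_treeChildFinset.1 hp).2
    rw [hG.isTree.distSum_child hp, ih p (by omega), hG.card_treeDescendants, hG.card_eq, hk]
    push_cast; ring

/-- Two vertices of a perfect ternary tree lie `i` and `j` levels below their lowest common
ancestor, which has level `c`; this determines the sum of squared distance differences. -/
theorem exists_levels (hG : IsPerfectTree 3 G r h) (x y : V) :
    ∃ c i j : ℕ, G.dist r x = c + i ∧ G.dist r y = c + j ∧ G.dist x y = i + j ∧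
      distDiffSqSum G x y = 3 ^ (h + 1) / 2 * ((i : ℝ) - j) ^ 2 -
        ((i : ℝ) ^ 2 + 6 * i * j + j ^ 2) / 2 + 3 ^ (h + 1) / 2 * (1 / 3) ^ c *
          (8 - (2 * (i + j) + 4) * ((1 / 3) ^ i + (1 / 3) ^ j)) := by
  induction hD : G.dist x y generalizing x y with
  | zero =>
    have : x = y := hG.isTree.connected.dist_eq_zero_iff.1 hD
    subst this
    exact ⟨G.dist r x, 0, 0, by simp [distDiffSqSum]; ring⟩
  | succ D ih =>
    -- If `y` is not below `x`, then `x` can be replaced by its parent, which is closer to `y` and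
    -- lowers `i` by one.
    have key : ∀ x y : V, G.dist x y = D + 1 → y ∉ treeDescendants G r x →
        ∃ c i j : ℕ, G.dist r x = c + i ∧ G.dist r y = c + j ∧ D + 1 = i + j ∧
          distDiffSqSum G x y = 3 ^ (h + 1) / 2 * ((i : ℝ) - j) ^ 2 -
            ((i : ℝ) ^ 2 + 6 * i * j + j ^ 2) / 2 + 3 ^ (h + 1) / 2 * (1 / 3) ^ c *
              (8 - (2 * (i + j) + 4) * ((1 / 3) ^ i + (1 / 3) ^ j)) := by
      intro x y hD hy
      obtain ⟨p, hp⟩ := hG.exists_parent (c := x) (by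
        rintro rfl; exact hy (by simp [treeDescendants_root]))
      have hpd := (mem_treeChildFinset.1 hp).2
      have h1 := (hG.isTree.notMem_treeDescendants_child hp).1 hy
      obtain ⟨c, i, j, e1, e2, e3, e4⟩ := ih p y (by omega)
      refine ⟨c, i + 1, j, by omega, e2, by omega, ?_⟩
      have e5 : (G.dist p y : ℝ) = i + j := by
        rw [show G.dist p y = i + j by omega]; push_cast; rfl
      rw [hG.isTree.distDiffSqSum_child hp hy, e4, hG.distSum_eq p, hG.distSum_eq y,
        hG.card_treeDescendants, hG.card_eq, e5, hpd, e1, e2]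
      push_cast; ring
    by_cases hy : y ∈ treeDescendants G r x
    -- Two distinct vertices cannot lie below each other, and the formula is symmetric under
    -- exchanging them.
    · have hx : x ∉ treeDescendants G r y := by
        rw [mem_treeDescendants] at hy ⊢
        have := SimpleGraph.dist_comm (G := G) (u := x) (v := y)
        omega
      obtain ⟨c, i, j, e1, e2, e3, e4⟩ := key y x (by rwa [SimpleGraph.dist_comm]) hx
      refine ⟨c, j, i, e2, e1, by omega, ?_⟩
      rw [distDiffSqSum_comm, e4]; ring
    · exact key x y hD hy

end IsPerfectTree

end PerfectTree

/-! ### Green function of a grounded tree and the coherence -/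

section Green

/-- The Green function of a tree grounded at `x` and `y`. -/
noncomputable def treeGreen {V : Type*} (G : SimpleGraph V) (x y u v : V) : ℝ :=
  ((G.dist u x : ℝ) + G.dist v x - G.dist u v) / 2 -
    ((G.dist y x : ℝ) + G.dist u x - G.dist u y) / 2 *
      (((G.dist y x : ℝ) + G.dist v x - G.dist v y) / 2) / G.dist y x

theorem treeGreen_left {V : Type*} (G : SimpleGraph V) (x y v : V) :
    treeGreen G x y x v = 0 := by
  rw [treeGreen, SimpleGraph.dist_comm (u := v), SimpleGraph.dist_comm (u := x) (v := y)]
  simp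

theorem treeGreen_right {V : Type*} {G : SimpleGraph V} (hG : G.Connected) (x y v : V) :
    treeGreen G x y y v = 0 := by
  by_cases h : x = y
  · subst h; exact treeGreen_left G x x v
  · have : (G.dist y x : ℝ) ≠ 0 := by
      exact_mod_cast (hG.pos_dist_of_ne (Ne.symm h)).ne'
    rw [treeGreen, SimpleGraph.dist_comm (u := v) (v := y)]
    simp only [SimpleGraph.dist_self]
    field_simp
    push_cast
    ring

theorem treeGreen_self {V : Type*} (G : SimpleGraph V) (x y v : V) :
    treeGreen G x y v v =
      G.dist x v - ((G.dist x y : ℝ) + G.dist x v - G.dist y v) ^ 2 / (4 * G.dist x y) := by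
  rw [treeGreen, SimpleGraph.dist_self, SimpleGraph.dist_comm (u := v) (v := x),
    SimpleGraph.dist_comm (u := v) (v := y), SimpleGraph.dist_comm (u := y) (v := x)]
  push_cast; ring

variable {V : Type*} [Fintype V] [DecidableEq V]

theorem sum_followers (S : Finset V) (f : V → ℝ) :
    ∑ u : {i : V // i ∉ S}, f u = ∑ u, if u ∈ S then 0 else f u := by
  rw [← Finset.sum_subtype (Finset.univ.filter fun i => i ∉ S) (by simp) f, Finset.sum_filter]
  exact Finset.sum_congr rfl fun u _ => by split_ifs <;> simp_all

variable {G : SimpleGraph V} [DecidableRel G.Adj]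

/-- Deleting the leader columns amounts to setting `g` to zero on `S`; the second sum corrects for
this. It vanishes when `g` does on `S`, and it is the leaders' input when `g` is the state of the
dynamics. -/
theorem followerLaplacian_mulVec (S : Finset V) (g : V → ℝ) (u : {i : V // i ∉ S}) :
    (followerLaplacian G S).mulVec (fun w => g w) u =
      ∑ w ∈ G.neighborFinset u, (g u - g w) + ∑ w ∈ G.neighborFinset u with w ∈ S, g w := by
  have h1 : (followerLaplacian G S).mulVec (fun w => g w) u =
      (G.lapMatrix ℝ).mulVec (fun w => if w ∈ S then 0 else g w) u := by
    refine (sum_followers S fun w => G.lapMatrix ℝ u w * g w).trans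
      (Finset.sum_congr rfl fun w _ => ?_)
    by_cases hw : w ∈ S <;> simp [hw]
  rw [h1, SimpleGraph.lapMatrix_mulVec_apply, if_neg u.2, Finset.sum_sub_distrib,
    Finset.sum_const, SimpleGraph.card_neighborFinset_eq_degree, nsmul_eq_mul, Finset.sum_filter,
    sub_add, ← Finset.sum_sub_distrib]
  congr 1
  refine Finset.sum_congr rfl fun w _ => ?_
  split_ifs <;> simp

/-- As a function of its first argument, `treeGreen` is, up to a constant, a combination of the
distances to `x`, `v`, `y` with coefficients `(1 - κ)/2`, `-1/2`, `κ/2`. These sum to zero, so the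
terms `2 - degree` cancel and only the source at `v` remains. -/
theorem SimpleGraph.IsTree.sum_neighborFinset_treeGreen (hG : G.IsTree) {x y u : V} (v : V)
    (hx : u ≠ x) (hy : u ≠ y) :
    ∑ w ∈ G.neighborFinset u, (treeGreen G x y u v - treeGreen G x y w v) =
      if u = v then 1 else 0 := by
  have e1 := hG.sum_neighborFinset_dist u v
  have e2 := hG.sum_neighborFinset_dist u x
  have e3 := hG.sum_neighborFinset_dist u y
  rw [if_neg hx] at e2
  rw [if_neg hy] at e3
  set κ := ((G.dist y x : ℝ) + G.dist v x - G.dist v y) / 2 / G.dist y x with hκ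
  have : ∀ w, treeGreen G x y u v - treeGreen G x y w v =
      (1 / 2 - κ / 2) * ((G.dist u x : ℝ) - G.dist w x) - 1 / 2 * ((G.dist u v : ℝ) - G.dist w v)
        + κ / 2 * ((G.dist u y : ℝ) - G.dist w y) := by
    intro w
    simp only [treeGreen, mul_div_assoc, ← hκ]
    ring
  simp only [this, Finset.sum_add_distrib, Finset.sum_sub_distrib, ← Finset.mul_sum] at e1 e2 e3 ⊢
  rw [e1, e2, e3]
  split_ifs <;> ring

/-- The coherence of one or two leaders in a tree in terms of distances. -/
theorem SimpleGraph.IsTree.coherenceNF_pair (hG : G.IsTree) (x y : V) :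
    coherenceNF G {x, y} = 1 / 2 * ∑ v, treeGreen G x y v v := by
  have hzero : ∀ u ∈ ({x, y} : Finset V), ∀ v, treeGreen G x y u v = 0 := by
    intro u hu v
    rcases Finset.mem_insert.1 hu with rfl | hu
    · exact treeGreen_left G _ _ _
    · rw [Finset.mem_singleton.1 hu]; exact treeGreen_right hG.connected _ _ _
  have hinv : followerLaplacian G {x, y} * Matrix.of (fun u v => treeGreen G x y u.1 v.1) = 1 := by
    ext u v
    have hu := u.2
    simp only [Finset.mem_insert, Finset.mem_singleton, not_or] at hu
    refine (followerLaplacian_mulVec {x, y} (fun w => treeGreen G x y w v) u).trans ?_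
    rw [hG.sum_neighborFinset_treeGreen _ hu.1 hu.2, Finset.sum_eq_zero
      (fun w hw => hzero w (Finset.mem_filter.1 hw).2 v), add_zero, Matrix.one_apply]
    simp only [Subtype.ext_iff]
  rw [coherenceNF, Matrix.inv_eq_right_inv hinv]
  congr 1
  refine (sum_followers {x, y} fun v => treeGreen G x y v v).trans
    (Finset.sum_congr rfl fun v _ => ?_)
  split_ifs with h
  · rw [hzero v h]
  · rfl

/-- The pair formula with `y = x`, where the correction term reads `0 / 0 = 0`. -/
theorem SimpleGraph.IsTree.coherenceNF_singleton (hG : G.IsTree) (x : V) :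
    coherenceNF G {x} = 1 / 2 * distSum G x := by
  have := hG.coherenceNF_pair x x
  rw [Finset.pair_eq_singleton] at this
  rw [this, distSum]
  congr 1
  exact Finset.sum_congr rfl fun v _ => by rw [treeGreen_self]; simp

/-- Expanding the square in `treeGreen_self` around `D = d(x,y)` makes the expression symmetric in
`x` and `y`. -/
theorem SimpleGraph.IsTree.coherenceNF_pair_of_ne (hG : G.IsTree) {x y : V} (hxy : x ≠ y) :
    coherenceNF G {x, y} = 1 / 2 * ((distSum G x + distSum G y) / 2 -
      Fintype.card V * G.dist x y / 4 - distDiffSqSum G x y / (4 * G.dist x y)) := by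
  have hD : (G.dist x y : ℝ) ≠ 0 := by exact_mod_cast (hG.connected.pos_dist_of_ne hxy).ne'
  have : ∀ v, treeGreen G x y v v = 1 / 2 * (G.dist x v : ℝ) + 1 / 2 * (G.dist y v : ℝ) -
      G.dist x y / 4 - ((G.dist x v : ℝ) - G.dist y v) ^ 2 / (4 * G.dist x y) := by
    intro v
    rw [treeGreen_self]; field_simp; ring
  rw [hG.coherenceNF_pair]
  simp only [this, Finset.sum_add_distrib, Finset.sum_sub_distrib, ← Finset.mul_sum,
    ← Finset.sum_div, distSum, distDiffSqSum, Finset.sum_const, nsmul_eq_mul, Finset.card_univ]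
  ring

/-- In a tree a second leader strictly decreases the coherence. -/
theorem SimpleGraph.IsTree.coherenceNF_pair_lt (hG : G.IsTree) {x y : V} (hxy : x ≠ y) :
    coherenceNF G {x, y} < coherenceNF G {x} := by
  have hD : (0 : ℝ) < G.dist x y := by exact_mod_cast hG.connected.pos_dist_of_ne hxy
  rw [hG.coherenceNF_pair, hG.coherenceNF_singleton, distSum]
  refine mul_lt_mul_of_pos_left (Finset.sum_lt_sum (fun v _ => ?_) ⟨y, Finset.mem_univ y, ?_⟩)
    (by norm_num)
  · rw [treeGreen_self]
    have : 0 ≤ ((G.dist x y : ℝ) + G.dist x v - G.dist y v) ^ 2 / (4 * G.dist x y) := by positivity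
    linarith
  · rwa [treeGreen_right hG.connected]

end Green

/-! ### Minimizing the cost over levels -/

section Optimization

/-- Twice the coherence of a pair of vertices lying `i` and `j` levels below their lowest common
ancestor at level `c`, relative to the sum of the levels of all vertices; here `2 * N + 1` is
twice the number of vertices plus two. -/
noncomputable def pairCost (N : ℝ) (c i j : ℕ) : ℝ :=
  c * (N + 1 / 2) - N + (N + 1 / 2) * (i * j) / (i + j) + (i + j) / 2 +
    N * (1 / 3) ^ c * ((((1 / 3) ^ i + (1 / 3) ^ j) * (i + j + 1) - 2) / (i + j))

theorem pairCost_comm (N : ℝ) (c i j : ℕ) : pairCost N c i j = pairCost N c j i := by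
  unfold pairCost; ring

theorem pairCost_zero_one_one (N : ℝ) : pairCost N 0 1 1 = 5 / 4 - N / 2 := by
  norm_num [pairCost]; ring

/-- This is the coefficient of `N` in `i + j` times the excess over the pair `(1, 1)`, where it
vanishes. The value `1/6` is attained at `(0, 1)`. Small cases are computed; for `3 ≤ j` the
polynomial part dominates. -/
theorem one_sixth_le_of_lt {i j : ℕ} (hij : i ≤ j) (hj : 1 ≤ j) (h : ¬(i = 1 ∧ j = 1)) :
    (1 / 6 : ℝ) ≤
      i * j - (i + j) / 2 - 2 + (i + j + 1) * ((1 / 3) ^ i + (1 / 3) ^ j) := by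
  have hq : (0 : ℝ) < (1 / 3) ^ j := by positivity
  have hp : (0 : ℝ) < (1 / 3) ^ i := by positivity
  obtain rfl | rfl | hi : i = 0 ∨ i = 1 ∨ 2 ≤ i := by omega
  · obtain rfl | rfl | hj3 : j = 1 ∨ j = 2 ∨ 3 ≤ j := by omega
    · norm_num
    · norm_num
    · have : (3 : ℝ) ≤ j := by exact_mod_cast hj3
      push_cast
      nlinarith
  · obtain rfl | hj3 : j = 2 ∨ 3 ≤ j := by omega
    · norm_num
    · have : (3 : ℝ) ≤ j := by exact_mod_cast hj3
      push_cast
      nlinarith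
  · obtain ⟨rfl, rfl⟩ | hj3 : (i = 2 ∧ j = 2) ∨ 3 ≤ j := by omega
    · norm_num
    · have h3 : (3 : ℝ) ≤ j := by exact_mod_cast hj3
      have h2 : (2 : ℝ) ≤ i := by exact_mod_cast hi
      have : 0 ≤ ((i : ℝ) + j + 1) * ((1 / 3) ^ i + (1 / 3) ^ j) := by positivity
      nlinarith

theorem lt_pairCost_zero {N : ℝ} (hN : 121 ≤ N) {i j : ℕ} (hD : 1 ≤ i + j)
    (h : ¬(i = 1 ∧ j = 1)) : 5 / 4 - N / 2 < pairCost N 0 i j := by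
  wlog hij : i ≤ j generalizing i j
  · rw [pairCost_comm]
    exact this (by omega) (by omega) (by omega)
  have hK := one_sixth_le_of_lt hij (by omega) h
  have hD' : (0 : ℝ) < (i : ℝ) + j := by exact_mod_cast hD
  set K := (i : ℝ) * j - (i + j) / 2 - 2 + (i + j + 1) * ((1 / 3) ^ i + (1 / 3) ^ j) with hKdef
  have hcost : pairCost N 0 i j - (5 / 4 - N / 2) =
      (N * K + i * j / 2 + ((i + j : ℝ) ^ 2 / 2 - 5 / 4 * (i + j))) / (i + j) := by
    rw [pairCost, hKdef]; field_simp; push_cast; ring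
  -- The quadratic in `i + j` is at least `-25/32`, which `N / 6` outweighs.
  have hpos : 0 < N * K + i * j / 2 + ((i + j : ℝ) ^ 2 / 2 - 5 / 4 * (i + j)) := by
    have h1 : 121 * (1 / 6) ≤ N * K := mul_le_mul hN hK (by norm_num) (by linarith)
    have h2 : (0 : ℝ) ≤ i * j / 2 := by positivity
    nlinarith [sq_nonneg ((i : ℝ) + j - 5 / 4)]
  have := div_pos hpos hD'
  linarith

/-- Lowering the common ancestor to level `c` costs `c * (N + 1/2)` and saves at most `N * (1 -
3^(-c)) * (4/3) ≤ N * c`. -/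
theorem pairCost_zero_lt {N : ℝ} (hN : 0 ≤ N) {c i j : ℕ} (hD : 1 ≤ i + j) (hc : 1 ≤ c) :
    pairCost N 0 i j < pairCost N c i j := by
  have hD' : (1 : ℝ) ≤ (i : ℝ) + j := by exact_mod_cast hD
  have hc' : (1 : ℝ) ≤ c := by exact_mod_cast hc
  set a : ℝ := (1 / 3) ^ i + (1 / 3) ^ j with ha
  set E : ℝ := (1 / 3) ^ c with hE
  have ha' : a ≤ 4 / 3 := by
    have h1 : ∀ k : ℕ, ((1 / 3 : ℝ)) ^ k ≤ 1 := fun k => pow_le_one₀ (by norm_num) (by norm_num)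
    have h2 : ∀ k : ℕ, 1 ≤ k → ((1 / 3 : ℝ)) ^ k ≤ 1 / 3 := fun k hk =>
      pow_le_of_le_one (by norm_num) (by norm_num) (by omega)
    rcases Nat.eq_zero_or_pos i with hi | hi
    · have := h1 i; have := h2 j (by omega); linarith
    · have := h1 j; have := h2 i hi; linarith
  have hE0 : 0 ≤ 1 - E := sub_nonneg.2 (pow_le_one₀ (by norm_num) (by norm_num))
  have hcE : (1 - E) * (4 / 3) ≤ c := by
    obtain rfl | h2 : c = 1 ∨ 2 ≤ c := by omega
    · norm_num [hE]
    · have : (2 : ℝ) ≤ c := by exact_mod_cast h2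
      have : 0 < E := by positivity
      linarith
  have hb : (a * (i + j + 1) - 2) / (i + j) ≤ 4 / 3 := by
    rw [div_le_iff₀ (by linarith)]
    nlinarith
  have hdiff : pairCost N c i j - pairCost N 0 i j =
      N * (c - (1 - E) * ((a * (i + j + 1) - 2) / (i + j))) + c / 2 := by
    simp only [pairCost, ← ha, ← hE]; push_cast; ring
  have : 0 ≤ N * (c - (1 - E) * ((a * (i + j + 1) - 2) / (i + j))) :=
    mul_nonneg hN (by linarith [mul_le_mul_of_nonneg_left hb hE0])
  linarith

theorem lt_pairCost {N : ℝ} (hN : 121 ≤ N) {c i j : ℕ} (hD : 1 ≤ i + j)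
    (h : ¬(c = 0 ∧ i = 1 ∧ j = 1)) : 5 / 4 - N / 2 < pairCost N c i j := by
  rcases Nat.eq_zero_or_pos c with rfl | hc
  · exact lt_pairCost_zero hN hD (by simpa using h)
  · refine lt_of_le_of_lt ?_ (pairCost_zero_lt (by linarith) hD hc)
    by_cases h1 : i = 1 ∧ j = 1
    · rw [h1.1, h1.2, pairCost_zero_one_one]
    · exact (lt_pairCost_zero hN hD h1).le

/-- The root has two children; they are at distance 2. -/
theorem IsPerfectTree.exists_pair {V : Type*} [Fintype V] {G : SimpleGraph V} {r : V} {h : ℕ}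
    (hG : IsPerfectTree 3 G r h) (hh : 4 ≤ h) :
    ∃ x y : V, G.dist x y = 2 ∧ G.dist x r = 1 ∧ G.dist y r = 1 := by
  have hcard := hG.card_treeChildFinset (v := r) (by simp; omega)
  obtain ⟨x, hx, y, hy, hne⟩ := Finset.one_lt_card.1 (by omega : 1 < (treeChildFinset G r r).card)
  rw [mem_treeChildFinset, SimpleGraph.dist_self] at hx hy
  have hpos := hG.isTree.connected.pos_dist_of_ne hne
  have htri := hG.isTree.connected.dist_triangle (u := x) (v := r) (w := y)
  have c1 := SimpleGraph.dist_comm (G := G) (u := x) (v := r)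
  have c2 := SimpleGraph.dist_comm (G := G) (u := y) (v := r)
  have h1 : G.dist x y ≠ 1 := fun h1 => by
    have := hG.isTree.dist_eq_or (SimpleGraph.dist_eq_one_iff_adj.1 h1) r
    omega
  exact ⟨x, y, by omega, by omega, by omega⟩

variable {V : Type*} [Fintype V] [DecidableEq V] {G : SimpleGraph V} [DecidableRel G.Adj]
  {r : V} {h : ℕ}

namespace IsPerfectTree

theorem exists_coherenceNF_pair_eq (hG : IsPerfectTree 3 G r h) {x y : V} (hxy : x ≠ y) :
    ∃ c i j : ℕ, G.dist r x = c + i ∧ G.dist r y = c + j ∧ G.dist x y = i + j ∧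
      coherenceNF G {x, y} = 1 / 2 * (distSum G r + pairCost (3 ^ (h + 1) / 2) c i j) := by
  obtain ⟨c, i, j, e1, e2, e3, e4⟩ := hG.exists_levels x y
  refine ⟨c, i, j, e1, e2, e3, ?_⟩
  have hpos := hG.isTree.connected.pos_dist_of_ne hxy
  rw [e3] at hpos
  have hD : (i : ℝ) + j ≠ 0 := by exact_mod_cast hpos.ne'
  rw [hG.isTree.coherenceNF_pair_of_ne hxy, e4, hG.distSum_eq x, hG.distSum_eq y, hG.card_eq,
    e1, e2, e3, pairCost]
  push_cast
  field_simp
  ring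

theorem coherenceNF_pair_eq (hG : IsPerfectTree 3 G r h) {x y : V} (hxy : G.dist x y = 2)
    (hx : G.dist x r = 1) (hy : G.dist y r = 1) :
    coherenceNF G {x, y} = 1 / 2 * (distSum G r + (5 / 4 - 3 ^ (h + 1) / 2 / 2)) := by
  have hne : x ≠ y := by rintro rfl; simp at hxy
  obtain ⟨c, i, j, e1, e2, e3, e4⟩ := hG.exists_coherenceNF_pair_eq hne
  rw [SimpleGraph.dist_comm] at hx hy
  obtain ⟨rfl, rfl, rfl⟩ : c = 0 ∧ i = 1 ∧ j = 1 := by omega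
  rw [e4, pairCost_zero_one_one]

theorem lt_coherenceNF_pair (hG : IsPerfectTree 3 G r h) (hh : 4 ≤ h) {x y : V} (hne : x ≠ y)
    (hxy : ¬(G.dist x y = 2 ∧ G.dist x r = 1 ∧ G.dist y r = 1)) :
    1 / 2 * (distSum G r + (5 / 4 - 3 ^ (h + 1) / 2 / 2)) < coherenceNF G {x, y} := by
  obtain ⟨c, i, j, e1, e2, e3, e4⟩ := hG.exists_coherenceNF_pair_eq hne
  have hpos := hG.isTree.connected.pos_dist_of_ne hne
  rw [SimpleGraph.dist_comm (u := x) (v := r), SimpleGraph.dist_comm (u := y) (v := r)] at hxy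
  have hN : (121 : ℝ) ≤ 3 ^ (h + 1) / 2 := by
    have : (3 : ℝ) ^ 5 ≤ 3 ^ (h + 1) := pow_le_pow_right₀ (by norm_num) (by omega)
    norm_num at this; linarith
  have := lt_pairCost hN (c := c) (i := i) (j := j) (by omega) (by omega)
  rw [e4]
  linarith

/-- The coherence of two children of the root is less than that of any other set of at most two
leaders. -/
theorem lt_coherenceNF (hG : IsPerfectTree 3 G r h) (hh : 4 ≤ h) {S : Finset V}
    (hS : S.Nonempty) (hcard : S.card ≤ 2)
    (hSxy : ¬∃ x y : V, S = {x, y} ∧ G.dist x y = 2 ∧ G.dist x r = 1 ∧ G.dist y r = 1) :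
    1 / 2 * (distSum G r + (5 / 4 - 3 ^ (h + 1) / 2 / 2)) < coherenceNF G S := by
  have hpair : ∀ x y : V, x ≠ y →
      1 / 2 * (distSum G r + (5 / 4 - 3 ^ (h + 1) / 2 / 2)) ≤ coherenceNF G {x, y} := by
    intro x y hne
    by_cases hxy : G.dist x y = 2 ∧ G.dist x r = 1 ∧ G.dist y r = 1
    · rw [hG.coherenceNF_pair_eq hxy.1 hxy.2.1 hxy.2.2]
    · exact (hG.lt_coherenceNF_pair hh hne hxy).le
  have hpos := hS.card_pos
  obtain h1 | h2 : S.card = 1 ∨ S.card = 2 := by omega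
  -- A single leader loses strictly to a pair containing it, and no pair beats the claimed optimum.
  · obtain ⟨x, rfl⟩ := Finset.card_eq_one.1 h1
    obtain ⟨a, b, hab, ha, hb⟩ := hG.exists_pair hh
    obtain ⟨y, hy⟩ : ∃ y, x ≠ y := by
      by_cases hxa : x = a
      · exact ⟨r, by rintro rfl; subst hxa; simp at ha⟩
      · exact ⟨a, hxa⟩
    exact (hpair x y hy).trans_lt (hG.isTree.coherenceNF_pair_lt hy)
  · obtain ⟨x, y, hne, rfl⟩ := Finset.card_eq_two.1 h2
    exact hG.lt_coherenceNF_pair hh hne fun hxy => hSxy ⟨x, y, rfl, hxy⟩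

theorem isOptimalLeaderSet_iff (hG : IsPerfectTree 3 G r h) (hh : 4 ≤ h) (S : Finset V) :
    IsOptimalLeaderSet G 2 S ↔
      ∃ x y : V, S = {x, y} ∧ G.dist x y = 2 ∧ G.dist x r = 1 ∧ G.dist y r = 1 := by
  constructor
  · rintro ⟨hS, hcard, hmin⟩
    by_contra hSxy
    obtain ⟨a, b, hab, ha, hb⟩ := hG.exists_pair hh
    have h1 := hG.lt_coherenceNF hh hS hcard hSxy
    have h2 := hmin {a, b} (by simp) Finset.card_le_two
    rw [hG.coherenceNF_pair_eq hab ha hb] at h2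
    linarith
  · rintro ⟨x, y, rfl, hxy, hx, hy⟩
    refine ⟨by simp, Finset.card_le_two, fun T hT hcard => ?_⟩
    by_cases hTxy : ∃ x y : V, T = {x, y} ∧ G.dist x y = 2 ∧ G.dist x r = 1 ∧ G.dist y r = 1
    · obtain ⟨a, b, rfl, hab, ha, hb⟩ := hTxy
      rw [hG.coherenceNF_pair_eq hab ha hb, hG.coherenceNF_pair_eq hxy hx hy]
    · rw [hG.coherenceNF_pair_eq hxy hx hy]
      exact (hG.lt_coherenceNF hh hT hcard hTxy).le

theorem exists_isOptimalLeaderSet (hG : IsPerfectTree 3 G r h) (hh : 4 ≤ h) :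
    ∃ S : Finset V, IsOptimalLeaderSet G 2 S := by
  obtain ⟨x, y, hxy⟩ := hG.exists_pair hh
  exact ⟨{x, y}, (hG.isOptimalLeaderSet_iff hh _).2 ⟨x, y, rfl, hxy⟩⟩

theorem coherenceNF_of_isOptimalLeaderSet (hG : IsPerfectTree 3 G r h) (hh : 4 ≤ h)
    {S : Finset V} (hS : IsOptimalLeaderSet G 2 S) :
    coherenceNF G S = (2 * (Fintype.card V : ℝ) + 1) / 4 *
      (Real.logb 3 (2 * (Fintype.card V : ℝ) + 1) - 2) + 1 := by
  obtain ⟨x, y, rfl, hxy, hx, hy⟩ := (hG.isOptimalLeaderSet_iff hh S).1 hS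
  have hn : 2 * (Fintype.card V : ℝ) + 1 = 3 ^ (h + 1) := by rw [hG.card_eq]; ring
  rw [hG.coherenceNF_pair_eq hxy hx hy, hG.distSum_root, hn, Real.logb_pow,
    Real.logb_self_eq_one (by norm_num)]
  push_cast; ring

end IsPerfectTree

end Optimization

/-! ### Scalar linear equation and exponential kernels -/

section Noise

theorem hasDerivAt_exp_kernel (l t s : ℝ) :
    HasDerivAt (fun s => Real.exp (-(l * (t - s)))) (Real.exp (-(l * (t - s))) * l) s := by
  have : HasDerivAt (fun s => -(l * (t - s))) l s := by
    simpa using (((hasDerivAt_id s).const_sub t).const_mul l).fun_neg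
  exact this.exp

/-- The path `b` is merely continuous, so the integrating factor is applied to the differentiable
part `q = y - b`. The noise then enters as `b t - ∫ l e^{-l(t-s)} b s ds`, the integrated-by-parts
form of `∫ e^{-l(t-s)} db`, and no stochastic integral is needed. -/
theorem eq_variation_of_constants {l c y₀ : ℝ} {y b : ℝ → ℝ} (hyc : ContinuousOn y (Set.Ici 0))
    (hbc : ContinuousOn b (Set.Ici 0))
    (hy : ∀ t, 0 ≤ t → y t = y₀ + (∫ s in (0 : ℝ)..t, (-l * y s + c * Real.exp (-s))) + b t)
    {t : ℝ} (ht : 0 ≤ t) :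
    y t = Real.exp (-(l * t)) * y₀ +
      (∫ s in (0 : ℝ)..t, Real.exp (-(l * (t - s))) * Real.exp (-s)) * c +
      (b t - ∫ s in (0 : ℝ)..t, l * Real.exp (-(l * (t - s))) * b s) := by
  -- Continuity is known only on `[0, ∞)`; freezing the value at `0` extends it to all of `ℝ`.
  have hext : ∀ {f : ℝ → ℝ}, ContinuousOn f (Set.Ici 0) →
      ∃ f' : ℝ → ℝ, Continuous f' ∧ ∀ s, 0 ≤ s → f' s = f s := fun {f} hf =>
    ⟨fun s => f (max s 0), hf.comp_continuous (by fun_prop) fun s => Set.mem_Ici.2 (le_max_right _ _),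
      fun s hs => by simp only [max_eq_left hs]⟩
  obtain ⟨y', hy', hyy⟩ := hext hyc
  obtain ⟨b', hb', hbb'⟩ := hext hbc
  set q : ℝ → ℝ := fun s => y₀ + ∫ r in (0 : ℝ)..s, (-l * y' r + c * Real.exp (-r)) with hq
  have hvc : Continuous fun r => -l * y' r + c * Real.exp (-r) := by fun_prop
  have hqd : ∀ s, HasDerivAt q (-l * y' s + c * Real.exp (-s)) s := fun s =>
    (intervalIntegral.integral_hasDerivAt_right (hvc.intervalIntegrable _ _)
      hvc.stronglyMeasurable.stronglyMeasurableAtFilter hvc.continuousAt).const_add y₀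
  have hqy : ∀ s, 0 ≤ s → y s = q s + b s := by
    intro s hs
    rw [hy s hs, hq]
    congr 2
    refine intervalIntegral.integral_congr fun r hr => ?_
    rw [Set.uIcc_of_le hs] at hr
    simp only [hyy r hr.1]
  have hFd : ∀ s ∈ Set.uIcc 0 t, HasDerivAt (fun s => Real.exp (-(l * (t - s))) * q s)
      (Real.exp (-(l * (t - s))) * Real.exp (-s) * c -
        l * Real.exp (-(l * (t - s))) * b' s) s := by
    intro s hs
    rw [Set.uIcc_of_le ht] at hs
    refine ((hasDerivAt_exp_kernel l t s).fun_mul (hqd s)).congr_deriv ?_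
    rw [hyy s hs.1, hbb' s hs.1, hqy s hs.1]
    ring
  have hFTC := intervalIntegral.integral_eq_sub_of_hasDerivAt hFd
    (Continuous.intervalIntegrable (by fun_prop) _ _)
  rw [intervalIntegral.integral_sub (Continuous.intervalIntegrable (by fun_prop) _ _)
    (Continuous.intervalIntegrable (by fun_prop) _ _), intervalIntegral.integral_mul_const] at hFTC
  have hbb : ∫ s in (0 : ℝ)..t, l * Real.exp (-(l * (t - s))) * b' s =
      ∫ s in (0 : ℝ)..t, l * Real.exp (-(l * (t - s))) * b s := by
    refine intervalIntegral.integral_congr fun r hr => ?_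
    rw [Set.uIcc_of_le ht] at hr
    simp only [hbb' r hr.1]
  rw [hbb] at hFTC
  have hq0 : q 0 = y₀ := by simp [hq]
  rw [hq0] at hFTC
  simp only [sub_self, mul_zero, neg_zero, Real.exp_zero, one_mul, sub_zero] at hFTC
  rw [hqy t ht]
  linarith

/-- With `m = min l 1` the integrand is at most `e^{-mt}`, so `t * e^{-mt}` dominates the integral
even in the resonant case `l = 1`. -/
theorem tendsto_integral_exp_mul_exp {l : ℝ} (hl : 0 < l) :
    Tendsto (fun t => ∫ s in (0 : ℝ)..t, Real.exp (-(l * (t - s))) * Real.exp (-s)) atTop (𝓝 0) := by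
  set m := min l 1
  have hm : 0 < m := lt_min hl one_pos
  have hlim : Tendsto (fun t : ℝ => t * Real.exp (-(m * t))) atTop (𝓝 0) := by
    have := (Real.tendsto_pow_mul_exp_neg_atTop_nhds_zero 1).comp
      (tendsto_id.const_mul_atTop hm)
    have h2 := this.const_mul (1 / m)
    simp only [mul_zero] at h2
    refine h2.congr fun t => ?_
    simp; field_simp
  refine squeeze_zero' ?_ ?_ hlim
  · filter_upwards [eventually_ge_atTop 0] with t ht
    exact intervalIntegral.integral_nonneg ht fun s _ => by positivity
  · filter_upwards [eventually_ge_atTop 0] with t ht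
    have : ∫ s in (0 : ℝ)..t, Real.exp (-(l * (t - s))) * Real.exp (-s) ≤
        ∫ s in (0 : ℝ)..t, Real.exp (-(m * t)) := by
      refine intervalIntegral.integral_mono_on ht (Continuous.intervalIntegrable (by fun_prop) _ _)
        (Continuous.intervalIntegrable (by fun_prop) _ _) fun s hs => ?_
      rw [← Real.exp_add]
      apply Real.exp_le_exp.2
      have h1 : m ≤ l := min_le_left _ _
      have h2 : m ≤ 1 := min_le_right _ _
      nlinarith [hs.1, hs.2]
    simpa using this

/-- This is the covariance of the noise at time `r` with its convolution up to time `t`. Splitting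
at `s = r` resolves the minimum. -/
theorem integral_exp_kernel_mul_min {l : ℝ} (hl : 0 < l) {r t : ℝ} (hr : 0 ≤ r) (hrt : r ≤ t) :
    ∫ s in (0 : ℝ)..t, l * Real.exp (-(l * (t - s))) * min s r =
      r - (Real.exp (-(l * (t - r))) - Real.exp (-(l * t))) / l := by
  have hc : Continuous fun s : ℝ => l * Real.exp (-(l * (t - s))) * min s r := by fun_prop
  have hE := hasDerivAt_exp_kernel l t
  rw [← intervalIntegral.integral_add_adjacent_intervals (hc.intervalIntegrable 0 r)
    (hc.intervalIntegrable r t)]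
  have h1 : ∫ s in (0 : ℝ)..r, l * Real.exp (-(l * (t - s))) * min s r =
      Real.exp (-(l * (t - r))) * (r - 1 / l) - Real.exp (-(l * (t - 0))) * (0 - 1 / l) := by
    rw [intervalIntegral.integral_congr
      (g := fun s => Real.exp (-(l * (t - s))) * l * (s - 1 / l) + Real.exp (-(l * (t - s))) * 1)]
    · exact intervalIntegral.integral_eq_sub_of_hasDerivAt
        (fun s _ => (hE s).mul ((hasDerivAt_id s).sub_const (1 / l)))
        (Continuous.intervalIntegrable (by fun_prop) _ _)
    · intro s hs
      rw [Set.uIcc_of_le hr] at hs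
      simp only [min_eq_left hs.2]
      field_simp; ring
  have h2 : ∫ s in r..t, l * Real.exp (-(l * (t - s))) * min s r =
      Real.exp (-(l * (t - t))) * r - Real.exp (-(l * (t - r))) * r := by
    rw [intervalIntegral.integral_congr (g := fun s => Real.exp (-(l * (t - s))) * l * r)]
    · exact intervalIntegral.integral_eq_sub_of_hasDerivAt (fun s _ => (hE s).mul_const r)
        (Continuous.intervalIntegrable (by fun_prop) _ _)
    · intro s hs
      rw [Set.uIcc_of_le hrt] at hs
      simp only [min_eq_right hs.1]
      ring
  rw [h1, h2]
  simp
  field_simp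
  ring

/-- The outer integral in the second moment of the convolution, with the inner one given by
`integral_exp_kernel_mul_min`. -/
theorem integral_exp_kernel_sq {l : ℝ} (hl : 0 < l) (t : ℝ) :
    ∫ r in (0 : ℝ)..t, l * Real.exp (-(l * (t - r))) *
        (r - (Real.exp (-(l * (t - r))) - Real.exp (-(l * t))) / l) =
      t - (1 - Real.exp (-(l * t))) / l - (1 - Real.exp (-(l * t)) ^ 2) / (2 * l) +
        Real.exp (-(l * t)) * (1 - Real.exp (-(l * t))) / l := by
  have hE := hasDerivAt_exp_kernel l t
  have hd : ∀ s ∈ Set.uIcc 0 t, HasDerivAt (fun s => Real.exp (-(l * (t - s))) *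
      (s - 1 / l + Real.exp (-(l * t)) / l - Real.exp (-(l * (t - s))) / (2 * l)))
      (l * Real.exp (-(l * (t - s))) *
        (s - (Real.exp (-(l * (t - s))) - Real.exp (-(l * t))) / l)) s := by
    intro s _
    refine ((hE s).fun_mul ((((hasDerivAt_id' s).sub_const (1 / l)).add_const
      (Real.exp (-(l * t)) / l)).fun_sub ((hE s).div_const (2 * l)))).congr_deriv ?_
    field_simp
    ring
  rw [intervalIntegral.integral_eq_sub_of_hasDerivAt hd
    (Continuous.intervalIntegrable (by fun_prop) _ _)]
  simp
  field_simp
  ring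

end Noise

/-! ### Second moments of the Ornstein-Uhlenbeck process -/

section NoiseMoments

variable {Ω : Type*} [MeasurableSpace Ω] {P : Measure Ω}
  {ι : Type*} [DecidableEq ι] {W : ι → ℝ → Ω → ℝ}

namespace IsIntegratedWhiteNoise

/-- The paths, frozen at negative times, are jointly measurable. -/
theorem measurable_uncurry (hW : IsIntegratedWhiteNoise P W) (i : ι) :
    Measurable fun p : ℝ × Ω => W i (max p.1 0) p.2 :=
  measurable_uncurry_of_continuous_of_measurable (u := fun s ω => W i (max s 0) ω)
    (fun ω => (hW.continuousOn i ω).comp_continuous (by fun_prop)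
      fun _ => Set.mem_Ici.2 (le_max_right _ _))
    (fun s => hW.measurable i _ (le_max_right _ _))

theorem integrable_mul (hW : IsIntegratedWhiteNoise P W) (i : ι) {s t : ℝ} (hs : 0 ≤ s)
    (ht : 0 ≤ t) : Integrable (fun ω => W i s ω * W i t ω) P :=
  (hW.memLp i s hs).integrable_mul (hW.memLp i t ht)

theorem integral_sq (hW : IsIntegratedWhiteNoise P W) (i : ι) {t : ℝ} (ht : 0 ≤ t) :
    ∫ ω, W i t ω ^ 2 ∂P = t := by
  have := hW.covariance i i t t ht ht
  simpa [sq] using this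

theorem integral_norm_mul_le (hW : IsIntegratedWhiteNoise P W) (i : ι) {s t : ℝ} (hs : 0 ≤ s)
    (ht : 0 ≤ t) : ∫ ω, ‖W i s ω * W i t ω‖ ∂P ≤ (s + t) / 2 := by
  have hs2 := (hW.memLp i s hs).integrable_sq
  have ht2 := (hW.memLp i t ht).integrable_sq
  calc ∫ ω, ‖W i s ω * W i t ω‖ ∂P ≤ ∫ ω, (W i s ω ^ 2 + W i t ω ^ 2) / 2 ∂P := by
        refine integral_mono (hW.integrable_mul i hs ht).norm ((hs2.add ht2).div_const 2)
          fun ω => ?_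
        simp only [norm_mul, Real.norm_eq_abs]
        nlinarith [sq_nonneg (|W i s ω| - |W i t ω|), sq_abs (W i s ω), sq_abs (W i t ω)]
    _ = (s + t) / 2 := by
        rw [integral_div, integral_add hs2 ht2, hW.integral_sq i hs, hW.integral_sq i ht]

variable [IsProbabilityMeasure P]

/-- Products of the noise at two random times, weighted with a bounded kernel, are jointly
integrable. -/
theorem integrable_prod (hW : IsIntegratedWhiteNoise P W) (i : ι) {α : Type*} [MeasurableSpace α]
    {μ : Measure α} [IsFiniteMeasure μ] {a b g : α → ℝ} (ha : Measurable a) (hb : Measurable b)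
    (hg : Measurable g) {C : ℝ}
    (hbd : ∀ᵐ z ∂μ, 0 ≤ a z ∧ a z ≤ C ∧ 0 ≤ b z ∧ b z ≤ C ∧ |g z| ≤ C) :
    Integrable (fun p : Ω × α => g p.2 * (W i (max (a p.2) 0) p.1 * W i (max (b p.2) 0) p.1))
      (P.prod μ) := by
  have hmeas : Measurable fun p : Ω × α =>
      g p.2 * (W i (max (a p.2) 0) p.1 * W i (max (b p.2) 0) p.1) :=
    (hg.comp measurable_snd).mul
      (((hW.measurable_uncurry i).comp ((ha.comp measurable_snd).prodMk measurable_fst)).mul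
      ((hW.measurable_uncurry i).comp ((hb.comp measurable_snd).prodMk measurable_fst)))
  rw [integrable_prod_iff' hmeas.aestronglyMeasurable]
  refine ⟨ae_of_all _ fun z => (hW.integrable_mul i (le_max_right (a z) 0)
    (le_max_right (b z) 0)).const_mul (g z), ?_⟩
  refine Integrable.of_bound (C := C * C)
    hmeas.norm.stronglyMeasurable.integral_prod_left'.aestronglyMeasurable ?_
  filter_upwards [hbd] with z hz
  obtain ⟨ha0, haC, hb0, hbC, hgC⟩ := hz
  rw [Real.norm_of_nonneg (integral_nonneg fun _ => norm_nonneg _)]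
  simp only [norm_mul (g z), integral_const_mul]
  have h1 := hW.integral_norm_mul_le i (le_max_right (a z) 0) (le_max_right (b z) 0)
  rw [max_eq_left ha0, max_eq_left hb0] at h1 ⊢
  exact mul_le_mul hgC (by linarith) (integral_nonneg fun _ => norm_nonneg _) (by linarith)

/-- The stationary part of the Ornstein-Uhlenbeck process driven by the noise has the expected
second moment. -/
theorem memLp_and_integral_sq_convolution (hW : IsIntegratedWhiteNoise P W) (i : ι) {l : ℝ}
    (hl : 0 < l) {t : ℝ} (ht : 0 ≤ t) :
    MemLp (fun ω => W i t ω - ∫ s in (0 : ℝ)..t, l * Real.exp (-(l * (t - s))) * W i s ω) 2 P ∧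
      ∫ ω, (W i t ω - ∫ s in (0 : ℝ)..t, l * Real.exp (-(l * (t - s))) * W i s ω) ^ 2 ∂P =
        (1 - Real.exp (-(l * t)) ^ 2) / (2 * l) := by
  set g : ℝ → ℝ := fun s => l * Real.exp (-(l * (t - s))) with hg
  have hgm : Measurable g := by fun_prop
  set μ : Measure ℝ := volume.restrict (Set.Ioc 0 t) with hμ
  have hbd : ∀ s ∈ Set.Ioc 0 t, 0 ≤ s ∧ s ≤ t ∧ |g s| ≤ l := by
    intro s hs
    refine ⟨hs.1.le, hs.2, ?_⟩
    rw [abs_of_nonneg (by positivity)]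
    refine mul_le_of_le_one_right hl.le (Real.exp_le_one_iff.2 ?_)
    nlinarith [hs.2]
  have hbdμ : ∀ᵐ s ∂μ, 0 ≤ s ∧ s ≤ t ∧ |g s| ≤ l :=
    (ae_restrict_mem measurableSet_Ioc).mono hbd
  set I : Ω → ℝ := fun ω => ∫ s, g s * W i (max s 0) ω ∂μ with hI
  have hIeq : ∀ ω, ∫ s in (0 : ℝ)..t, l * Real.exp (-(l * (t - s))) * W i s ω = I ω := by
    intro ω
    rw [intervalIntegral.integral_of_le ht]
    refine setIntegral_congr_fun measurableSet_Ioc fun s hs => ?_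
    simp only [max_eq_left hs.1.le, hg]
  have hImeas : StronglyMeasurable I := by
    have : Measurable fun p : Ω × ℝ => g p.2 * W i (max p.2 0) p.1 :=
      (hgm.comp measurable_snd).mul
        ((hW.measurable_uncurry i).comp (measurable_snd.prodMk measurable_fst))
    exact this.stronglyMeasurable.integral_prod_right'
  -- the mixed term
  have hmix := hW.integrable_prod i (μ := μ) (a := fun s => s) (b := fun _ => t) (g := g)
    (C := max t l) measurable_id measurable_const hgm (by
      filter_upwards [hbdμ] with s hs
      exact ⟨hs.1, hs.2.1.trans (le_max_left _ _), ht, le_max_left _ _,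
        hs.2.2.trans (le_max_right _ _)⟩)
  have hmixI : ∀ ω, ∫ s, g s * (W i (max s 0) ω * W i (max t 0) ω) ∂μ = I ω * W i t ω := by
    intro ω
    rw [hI, ← integral_mul_const, max_eq_left ht]
    simp only [mul_assoc]
  have hmixint : ∫ ω, I ω * W i t ω ∂P = t - (1 - Real.exp (-(l * t))) / l := by
    simp only [← hmixI]
    rw [integral_integral_swap hmix]
    have h1 := integral_exp_kernel_mul_min hl ht le_rfl
    simp only [sub_self, mul_zero, neg_zero, Real.exp_zero] at h1
    rw [← h1, intervalIntegral.integral_of_le ht]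
    refine setIntegral_congr_fun measurableSet_Ioc fun s hs => ?_
    simp only [integral_const_mul, max_eq_left hs.1.le, max_eq_left ht, hg,
      hW.covariance i i s t hs.1.le ht, if_true]
  -- the quadratic term
  have hsq := hW.integrable_prod i (μ := μ.prod μ) (a := fun z => z.1) (b := fun z => z.2)
    (g := fun z => g z.1 * g z.2) (C := max t (l * l)) measurable_fst measurable_snd
    ((hgm.comp measurable_fst).mul (hgm.comp measurable_snd)) (by
      rw [hμ, Measure.prod_restrict]
      filter_upwards [ae_restrict_mem (measurableSet_Ioc.prod measurableSet_Ioc)] with z hz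
      have h1 := hbd _ hz.1
      have h2 := hbd _ hz.2
      refine ⟨h1.1, h1.2.1.trans (le_max_left _ _), h2.1, h2.2.1.trans (le_max_left _ _), ?_⟩
      rw [abs_mul]
      exact (mul_le_mul h1.2.2 h2.2.2 (abs_nonneg _) hl.le).trans (le_max_right _ _))
  have hsqI : ∀ ω, ∫ z : ℝ × ℝ, g z.1 * g z.2 * (W i (max z.1 0) ω * W i (max z.2 0) ω) ∂μ.prod μ =
      I ω ^ 2 := by
    intro ω
    rw [sq, hI, ← integral_prod_mul]
    exact integral_congr_ae (ae_of_all _ fun z => by ring)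
  have hI2 : Integrable (fun ω => I ω ^ 2) P := by
    simpa only [hsqI] using hsq.integral_prod_left
  have hIL : MemLp I 2 P := (memLp_two_iff_integrable_sq hImeas.aestronglyMeasurable).2 hI2
  have hsqint : ∫ ω, I ω ^ 2 ∂P = t - (1 - Real.exp (-(l * t))) / l -
      (1 - Real.exp (-(l * t)) ^ 2) / (2 * l) +
        Real.exp (-(l * t)) * (1 - Real.exp (-(l * t))) / l := by
    simp only [← hsqI]
    rw [integral_integral_swap hsq]
    have hcov : ∀ z : ℝ × ℝ,
        ∫ ω, g z.1 * g z.2 * (W i (max z.1 0) ω * W i (max z.2 0) ω) ∂P =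
          g z.1 * g z.2 * min (max z.1 0) (max z.2 0) := by
      intro z
      rw [integral_const_mul, hW.covariance i i _ _ (le_max_right _ 0) (le_max_right _ 0),
        if_pos rfl]
    have hint : Integrable (fun z : ℝ × ℝ => g z.1 * g z.2 * min (max z.1 0) (max z.2 0))
        (μ.prod μ) := by
      simpa only [hcov] using hsq.integral_prod_right
    simp only [hcov]
    rw [integral_prod_symm _ hint, ← integral_exp_kernel_sq hl t, intervalIntegral.integral_of_le ht]
    refine setIntegral_congr_fun measurableSet_Ioc fun r hr => ?_
    simp only
    rw [← integral_exp_kernel_mul_min hl hr.1.le hr.2, intervalIntegral.integral_of_le ht,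
      ← integral_const_mul]
    refine setIntegral_congr_fun measurableSet_Ioc fun s hs => ?_
    simp only [max_eq_left hs.1.le, max_eq_left hr.1.le, hg]
    ring
  have hWL := hW.memLp i t ht
  simp only [hIeq]
  refine ⟨hWL.sub hIL, ?_⟩
  have hexp : ∀ ω, (W i t ω - I ω) ^ 2 = W i t ω ^ 2 - 2 * (I ω * W i t ω) + I ω ^ 2 :=
    fun ω => by ring
  simp only [hexp]
  have hcross : Integrable (fun ω => 2 * (I ω * W i t ω)) P :=
    (hIL.integrable_mul hWL).const_mul 2
  have hsub : Integrable (fun ω => W i t ω ^ 2 - 2 * (I ω * W i t ω)) P :=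
    hWL.integrable_sq.sub hcross
  rw [integral_add hsub hI2, integral_sub hWL.integrable_sq hcross, integral_const_mul]
  rw [hmixint, hsqint, hW.integral_sq i ht]
  field_simp
  ring

/-- The second moment of the solution of a scalar stable linear equation driven by the noise, with
an exponentially decaying input, tends to the stationary variance. -/
theorem tendsto_integral_sq (hW : IsIntegratedWhiteNoise P W) (i : ι) {l : ℝ} (hl : 0 < l)
    {y : ℝ → Ω → ℝ} {c : Ω → ℝ} (hc : MemLp c 2 P) (hy₀ : MemLp (y 0) 2 P)
    (hyc : ∀ ω, ContinuousOn (fun t => y t ω) (Set.Ici 0))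
    (hy : ∀ t, 0 ≤ t → ∀ ω,
      y t ω = y 0 ω + (∫ s in (0 : ℝ)..t, (-l * y s ω + c ω * Real.exp (-s))) + W i t ω) :
    (∀ t, 0 ≤ t → MemLp (y t) 2 P) ∧
      Tendsto (fun t => ∫ ω, y t ω ^ 2 ∂P) atTop (𝓝 (1 / (2 * l))) := by
  set κ : ℝ → ℝ := fun t => ∫ s in (0 : ℝ)..t, Real.exp (-(l * (t - s))) * Real.exp (-s) with hκ
  set ε : ℝ → ℝ := fun t => Real.exp (-(l * t)) with hε
  set Z : ℝ → Ω → ℝ := fun t ω =>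
    W i t ω - ∫ s in (0 : ℝ)..t, l * Real.exp (-(l * (t - s))) * W i s ω with hZ
  have hrep : ∀ t, 0 ≤ t → ∀ ω, y t ω = ε t * y 0 ω + κ t * c ω + Z t ω := fun t ht ω =>
    eq_variation_of_constants (hyc ω) (hW.continuousOn i ω) (fun t ht => hy t ht ω) ht
  have hZL : ∀ t, 0 ≤ t → MemLp (Z t) 2 P := fun t ht =>
    (hW.memLp_and_integral_sq_convolution i hl ht).1
  have hZ2 : ∀ t, 0 ≤ t → ∫ ω, Z t ω ^ 2 ∂P = (1 - ε t ^ 2) / (2 * l) := fun t ht =>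
    (hW.memLp_and_integral_sq_convolution i hl ht).2
  have hyL : ∀ t, 0 ≤ t → MemLp (y t) 2 P := by
    intro t ht
    rw [show y t = fun ω => ε t * y 0 ω + κ t * c ω + Z t ω from funext (hrep t ht)]
    exact ((hy₀.const_mul _).add (hc.const_mul _)).add (hZL t ht)
  refine ⟨hyL, ?_⟩
  have hε0 : Tendsto ε atTop (𝓝 0) :=
    Real.tendsto_exp_neg_atTop_nhds_zero.comp (tendsto_id.const_mul_atTop hl)
  have hκ0 : Tendsto κ atTop (𝓝 0) := tendsto_integral_exp_mul_exp hl
  -- The initial state may be correlated with the noise, so cross moments need not vanish. They are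
  -- bounded uniformly in `t`, and their prefactors `ε`, `κ` tend to zero.
  have hbdd : ∀ {f : Ω → ℝ}, MemLp f 2 P → ∀ t, 0 ≤ t →
      |∫ ω, f ω * Z t ω ∂P| ≤ (∫ ω, f ω ^ 2 ∂P + 1 / (2 * l)) / 2 := by
    intro f hf t ht
    calc |∫ ω, f ω * Z t ω ∂P| ≤ ∫ ω, |f ω * Z t ω| ∂P := abs_integral_le_integral_abs
      _ ≤ ∫ ω, (f ω ^ 2 + Z t ω ^ 2) / 2 ∂P := by
          refine integral_mono (hf.integrable_mul (hZL t ht)).abs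
            ((hf.integrable_sq.add (hZL t ht).integrable_sq).div_const 2) fun ω => ?_
          simp only [abs_mul]
          nlinarith [sq_nonneg (|f ω| - |Z t ω|), sq_abs (f ω), sq_abs (Z t ω)]
      _ ≤ _ := by
          rw [integral_div, integral_add hf.integrable_sq (hZL t ht).integrable_sq, hZ2 t ht]
          have : (1 - ε t ^ 2) / (2 * l) ≤ 1 / (2 * l) := by
            gcongr
            linarith [sq_nonneg (ε t)]
          linarith
  have hprod : ∀ {a : ℝ → ℝ}, Tendsto a atTop (𝓝 0) → ∀ {f : Ω → ℝ}, MemLp f 2 P →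
      Tendsto (fun t => a t * ∫ ω, f ω * Z t ω ∂P) atTop (𝓝 0) := by
    intro a ha f hf
    refine ha.zero_mul_isBoundedUnder_le ⟨(∫ ω, f ω ^ 2 ∂P + 1 / (2 * l)) / 2, ?_⟩
    rw [eventually_map]
    filter_upwards [eventually_ge_atTop 0] with t ht using hbdd hf t ht
  have hexp : ∀ t, 0 ≤ t → ∫ ω, y t ω ^ 2 ∂P =
      ε t ^ 2 * ∫ ω, y 0 ω ^ 2 ∂P + κ t ^ 2 * ∫ ω, c ω ^ 2 ∂P +
        2 * ε t * κ t * ∫ ω, y 0 ω * c ω ∂P + 2 * (ε t * ∫ ω, y 0 ω * Z t ω ∂P) +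
        2 * (κ t * ∫ ω, c ω * Z t ω ∂P) + (1 - ε t ^ 2) / (2 * l) := by
    intro t ht
    have h1 : Integrable (fun ω => ε t ^ 2 * y 0 ω ^ 2) P := hy₀.integrable_sq.const_mul _
    have h2 : Integrable (fun ω => κ t ^ 2 * c ω ^ 2) P := hc.integrable_sq.const_mul _
    have h3 : Integrable (fun ω => 2 * ε t * κ t * (y 0 ω * c ω)) P :=
      (hy₀.integrable_mul hc).const_mul _
    have h4 : Integrable (fun ω => 2 * ε t * (y 0 ω * Z t ω)) P :=
      (hy₀.integrable_mul (hZL t ht)).const_mul _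
    have h5 : Integrable (fun ω => 2 * κ t * (c ω * Z t ω)) P :=
      (hc.integrable_mul (hZL t ht)).const_mul _
    have h12 : Integrable (fun ω => ε t ^ 2 * y 0 ω ^ 2 + κ t ^ 2 * c ω ^ 2) P := h1.add h2
    have h13 : Integrable (fun ω => ε t ^ 2 * y 0 ω ^ 2 + κ t ^ 2 * c ω ^ 2 +
      2 * ε t * κ t * (y 0 ω * c ω)) P := h12.add h3
    have h14 : Integrable (fun ω => ε t ^ 2 * y 0 ω ^ 2 + κ t ^ 2 * c ω ^ 2 +
      2 * ε t * κ t * (y 0 ω * c ω) + 2 * ε t * (y 0 ω * Z t ω)) P := h13.add h4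
    have h15 : Integrable (fun ω => ε t ^ 2 * y 0 ω ^ 2 + κ t ^ 2 * c ω ^ 2 +
      2 * ε t * κ t * (y 0 ω * c ω) + 2 * ε t * (y 0 ω * Z t ω) +
        2 * κ t * (c ω * Z t ω)) P := h14.add h5
    have : ∀ ω, y t ω ^ 2 = ε t ^ 2 * y 0 ω ^ 2 + κ t ^ 2 * c ω ^ 2 +
        2 * ε t * κ t * (y 0 ω * c ω) + 2 * ε t * (y 0 ω * Z t ω) + 2 * κ t * (c ω * Z t ω) +
          Z t ω ^ 2 := fun ω => by rw [hrep t ht]; ring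
    simp only [this]
    rw [integral_add h15 (hZL t ht).integrable_sq, integral_add h14 h5, integral_add h13 h4,
      integral_add h12 h3, integral_add h1 h2, hZ2 t ht]
    simp only [integral_const_mul]
    ring
  have hlim := ((((((hε0.pow 2).mul_const (∫ ω, y 0 ω ^ 2 ∂P)).add
    ((hκ0.pow 2).mul_const (∫ ω, c ω ^ 2 ∂P))).add
    (((hε0.const_mul 2).mul hκ0).mul_const (∫ ω, y 0 ω * c ω ∂P))).add
    ((hprod hε0 hy₀).const_mul 2)).add ((hprod hκ0 hc).const_mul 2)).add
    (((hε0.pow 2).const_sub 1).div_const (2 * l))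
  simp only [ne_eq, OfNat.ofNat_ne_zero, not_false_eq_true, zero_pow, zero_mul, mul_zero, add_zero,
    zero_add, sub_zero] at hlim
  refine Tendsto.congr' ?_ hlim
  filter_upwards [eventually_ge_atTop 0] with t ht
  rw [hexp t ht]

end IsIntegratedWhiteNoise

end NoiseMoments

/-! ### Orthogonal diagonalization -/

section Diagonalization

/-- A real positive definite matrix is diagonalized by an orthogonal matrix. -/
theorem Matrix.PosDef.exists_orthogonal_diagonalization {n : Type*} [Fintype n] [DecidableEq n]
    {A : Matrix n n ℝ} (hA : A.PosDef) :
    ∃ (U : Matrix n n ℝ) (l : n → ℝ), (∀ k, 0 < l k) ∧ U * U.transpose = 1 ∧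
      U.transpose * U = 1 ∧ U.transpose * A = Matrix.diagonal l * U.transpose ∧
      A⁻¹.trace = ∑ k, (l k)⁻¹ := by
  set U : Matrix n n ℝ := hA.isHermitian.eigenvectorUnitary.1 with hU
  set l := hA.isHermitian.eigenvalues with hl
  have hstar : star U = U.transpose := by
    rw [Matrix.star_eq_conjTranspose, Matrix.conjTranspose_eq_transpose_of_trivial]
  have h1 : U * U.transpose = 1 := by
    rw [← hstar]; exact Unitary.coe_mul_star_self _
  have h2 : U.transpose * U = 1 := by
    rw [← hstar]; exact Unitary.coe_star_mul_self _
  have hspec : A = U * Matrix.diagonal l * U.transpose := by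
    have := hA.isHermitian.spectral_theorem
    rw [Unitary.conjStarAlgAut_apply] at this
    rw [← hstar]
    exact this
  have hpos : ∀ k, 0 < l k := fun k => hA.eigenvalues_pos k
  refine ⟨U, l, hpos, h1, h2, ?_, ?_⟩
  · conv_lhs => rw [hspec]
    rw [← Matrix.mul_assoc, ← Matrix.mul_assoc, h2, Matrix.one_mul]
  · have hinv : A * (U * Matrix.diagonal (fun k => (l k)⁻¹) * U.transpose) = 1 := by
      have hd : Matrix.diagonal l * Matrix.diagonal (fun k => (l k)⁻¹) = 1 := by
        rw [Matrix.diagonal_mul_diagonal, ← Matrix.diagonal_one]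
        congr 1
        ext k
        exact mul_inv_cancel₀ (hpos k).ne'
      calc A * (U * Matrix.diagonal (fun k => (l k)⁻¹) * U.transpose)
          = U * Matrix.diagonal l * (U.transpose * U) * Matrix.diagonal (fun k => (l k)⁻¹) *
              U.transpose := by
            conv_lhs => rw [hspec]
            simp only [Matrix.mul_assoc]
        _ = 1 := by
            rw [h2, Matrix.mul_one, Matrix.mul_assoc U, hd, Matrix.mul_one, h1]
    rw [Matrix.inv_eq_right_inv hinv, Matrix.trace_mul_comm, ← Matrix.mul_assoc, h2,
      Matrix.one_mul, Matrix.trace_diagonal]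

/-- Orthogonal transformations preserve the sum of squares. -/
theorem Matrix.sum_transpose_mulVec_sq {n : Type*} [Fintype n] [DecidableEq n]
    {U : Matrix n n ℝ} (hU : U * U.transpose = 1) (x : n → ℝ) :
    ∑ k, (∑ i, U i k * x i) ^ 2 = ∑ i, x i ^ 2 := by
  have h1 : ∀ k, ∑ i, U i k * x i = (U.transpose.mulVec x) k := fun k => rfl
  have h2 : ∀ y : n → ℝ, ∑ k, y k ^ 2 = y ⬝ᵥ y := fun y => by simp [dotProduct, sq]
  simp only [h1]
  rw [h2, h2, Matrix.dotProduct_mulVec, Matrix.vecMul_transpose, Matrix.mulVec_mulVec, hU,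
    Matrix.one_mulVec]

end Diagonalization

/-! ### Positive definiteness of the follower Laplacian -/

section Followers

variable {V : Type*} [Fintype V] [DecidableEq V] {G : SimpleGraph V} [DecidableRel G.Adj]

/-- After extension by zero, the form is that of the full Laplacian, which vanishes only on
functions constant on the connected graph; the value at a leader is `0`. -/
theorem SimpleGraph.Connected.posDef_followerLaplacian (hG : G.Connected) {S : Finset V}
    (hS : S.Nonempty) : (followerLaplacian G S).PosDef := by
  refine Matrix.PosDef.of_dotProduct_mulVec_pos
    ((G.isHermitian_lapMatrix (R := ℝ)).submatrix Subtype.val) fun x hx => ?_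
  set g : V → ℝ := fun w => if h : w ∈ S then 0 else x ⟨w, h⟩ with hg
  have hgx : ∀ u : {i : V // i ∉ S}, g u = x u := fun u => by simp [hg, u.2]
  have hgS : ∀ w ∈ S, g w = 0 := fun w hw => by simp [hg, hw]
  have hxg : x = fun w => g w.1 := funext fun u => (hgx u).symm
  have hquad : star x ⬝ᵥ (followerLaplacian G S).mulVec x =
      Matrix.toLinearMap₂' ℝ (G.lapMatrix ℝ) g g := by
    rw [star_trivial, Matrix.toLinearMap₂'_apply', hxg, dotProduct, dotProduct]
    have h1 : ∀ u : {i : V // i ∉ S}, (followerLaplacian G S).mulVec (fun w => g w) u =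
        (G.lapMatrix ℝ).mulVec g u := by
      intro u
      rw [followerLaplacian_mulVec, SimpleGraph.lapMatrix_mulVec_apply, Finset.sum_sub_distrib,
        Finset.sum_const, SimpleGraph.card_neighborFinset_eq_degree, nsmul_eq_mul,
        Finset.sum_eq_zero (s := Finset.filter _ _)
          fun w hw => hgS w (Finset.mem_filter.1 hw).2, add_zero]
    simp only [h1]
    refine (sum_followers S fun u => g u * (G.lapMatrix ℝ).mulVec g u).trans
      (Finset.sum_congr rfl fun u _ => ?_)
    split_ifs with h
    · rw [hgS u h, zero_mul]
    · rfl
  rw [hquad]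
  refine lt_of_le_of_ne ?_ fun h0 => hx ?_
  · rw [SimpleGraph.lapMatrix_toLinearMap₂']
    positivity
  · obtain ⟨s, hs⟩ := hS
    have := (G.lapMatrix_toLinearMap₂'_apply'_eq_zero_iff_forall_reachable g).1 h0.symm
    ext u
    rw [← hgx u, this u s (hG u s), hgS s hs]
    rfl

end Followers

/-! ### Steady-state variance of the followers -/

section FollowerVariance

/-- An orthogonal transformation of an integrated white noise is an integrated white noise. -/
theorem IsIntegratedWhiteNoise.orthogonal {Ω : Type*} [MeasurableSpace Ω] {P : Measure Ω}
    {n : Type*} [Fintype n] [DecidableEq n] {W : n → ℝ → Ω → ℝ}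
    (hW : IsIntegratedWhiteNoise P W) {U : Matrix n n ℝ} (hU : U.transpose * U = 1)
    [IsProbabilityMeasure P] :
    IsIntegratedWhiteNoise P fun k t ω => ∑ i, U i k * W i t ω where
  measurable k t ht := Finset.measurable_fun_sum _ fun i _ => (hW.measurable i t ht).const_mul _
  continuousOn k ω := continuousOn_finsetSum _ fun i _ => (hW.continuousOn i ω).const_mul _
  memLp k t ht := memLp_finsetSum _ fun i _ => (hW.memLp i t ht).const_mul _
  mean k t ht := by
    rw [integral_finsetSum _ fun i _ =>
      ((hW.memLp i t ht).integrable one_le_two).const_mul _]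
    simp [integral_const_mul, hW.mean _ t ht]
  covariance k l s t hs ht := by
    have hint : ∀ i j, Integrable (fun ω => U i k * U j l * (W i s ω * W j t ω)) P := fun i j =>
      ((hW.memLp i s hs).integrable_mul (hW.memLp j t ht)).const_mul _
    have hexp : ∀ ω, (∑ i, U i k * W i s ω) * ∑ j, U j l * W j t ω =
        ∑ i, ∑ j, U i k * U j l * (W i s ω * W j t ω) := by
      intro ω
      rw [Finset.sum_mul_sum]
      exact Finset.sum_congr rfl fun i _ => Finset.sum_congr rfl fun j _ => by ring
    simp only [hexp]
    rw [integral_finsetSum _ fun i _ => integrable_finsetSum _ fun j _ => hint i j]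
    simp only [integral_finsetSum _ fun j _ => hint _ j, integral_const_mul,
      hW.covariance _ _ s t hs ht, mul_ite, mul_zero, Finset.sum_ite_eq, Finset.mem_univ, if_true]
    rw [← Finset.sum_mul]
    have := congrFun (congrFun hU k) l
    simp only [Matrix.mul_apply, Matrix.transpose_apply, Matrix.one_apply] at this
    rw [this]
    split_ifs <;> simp

variable {V : Type*} [Fintype V] [DecidableEq V] {G : SimpleGraph V} [DecidableRel G.Adj]
  {S : Finset V} {Ω : Type*} [MeasurableSpace Ω] {P : Measure Ω}
  {W : {i : V // i ∉ S} → ℝ → Ω → ℝ} {X : V → ℝ → Ω → ℝ}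

namespace IsNoiseFreeLeaderProcess

theorem leader_eq (hX : IsNoiseFreeLeaderProcess G S P W X) {i : V} (hi : i ∈ S) {t : ℝ}
    (ht : 0 ≤ t) (ω : Ω) : X i t ω = X i 0 ω * Real.exp (-t) := by
  have := eq_variation_of_constants (l := 1) (c := 0) (y₀ := X i 0 ω) (b := fun _ => 0)
    (hX.continuousOn i ω) continuousOn_const
    (fun t ht => by rw [hX.leader i hi t ht ω]; simp) ht
  simpa [mul_comm] using this

/-- The rotated follower states satisfy decoupled scalar equations. -/
theorem rotated_eq (hX : IsNoiseFreeLeaderProcess G S P W X)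
    {U : Matrix {i : V // i ∉ S} {i : V // i ∉ S} ℝ} {l : {i : V // i ∉ S} → ℝ}
    (hUA : U.transpose * followerLaplacian G S = Matrix.diagonal l * U.transpose)
    (k : {i : V // i ∉ S}) {t : ℝ} (ht : 0 ≤ t) (ω : Ω) :
    ∑ i, U i k * X i t ω = ∑ i, U i k * X i 0 ω +
      (∫ s in (0 : ℝ)..t, (-l k * ∑ i, U i k * X i s ω +
        (∑ i, U i k * ∑ w ∈ G.neighborFinset i with w ∈ S, X w 0 ω) * Real.exp (-s))) +
      ∑ i, U i k * W i t ω := by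
  -- The leaders decay like `e^{-s}`, so their contribution to the drift is a fixed random variable
  -- times `e^{-s}`.
  have hdrift : ∀ s, 0 ≤ s →
      ∑ i, U i k * (-∑ j ∈ G.neighborFinset i, (X i s ω - X j s ω)) =
      -l k * ∑ i, U i k * X i s ω +
        (∑ i, U i k * ∑ w ∈ G.neighborFinset i with w ∈ S, X w 0 ω) * Real.exp (-s) := by
    intro s hs
    have h1 : ∀ i : {i : V // i ∉ S}, -∑ j ∈ G.neighborFinset i, (X i s ω - X j s ω) =
        -(followerLaplacian G S).mulVec (fun w => X w s ω) i +
          (∑ w ∈ G.neighborFinset i with w ∈ S, X w 0 ω) * Real.exp (-s) := by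
      intro i
      rw [followerLaplacian_mulVec S (fun w => X w s ω), Finset.sum_mul, Finset.sum_congr rfl
        fun w hw => hX.leader_eq (Finset.mem_filter.1 hw).2 hs ω]
      ring
    have h2 : ∑ i, U i k * (followerLaplacian G S).mulVec (fun w => X w s ω) i =
        l k * ∑ i, U i k * X i s ω := by
      have := congrFun (congrArg (fun M => M.mulVec fun w : {i : V // i ∉ S} => X w s ω) hUA) k
      simp only [← Matrix.mulVec_mulVec, Matrix.mulVec_diagonal] at this
      exact this
    simp only [h1, mul_add, mul_neg, Finset.sum_add_distrib, Finset.sum_neg_distrib, h2, neg_mul,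
      Finset.sum_mul, mul_assoc]
  have hcont : ∀ i : {i : V // i ∉ S}, ContinuousOn
      (fun s => U i k * (-∑ j ∈ G.neighborFinset i, (X i s ω - X j s ω))) (Set.uIcc 0 t) := by
    intro i
    have hsub : Set.uIcc 0 t ⊆ Set.Ici 0 := by
      rw [Set.uIcc_of_le ht]; exact Set.Icc_subset_Ici_self
    refine ContinuousOn.mono ?_ hsub
    exact continuousOn_const.mul (continuousOn_finsetSum _ fun j _ =>
      (hX.continuousOn i ω).sub (hX.continuousOn j ω)).neg
  rw [← intervalIntegral.integral_congr (μ := volume) (a := 0) (b := t) fun s hs => hdrift s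
    (by rw [Set.uIcc_of_le ht] at hs; exact hs.1),
    intervalIntegral.integral_finsetSum fun i _ => (hcont i).intervalIntegrable,
    ← Finset.sum_add_distrib, ← Finset.sum_add_distrib]
  refine Finset.sum_congr rfl fun i _ => ?_
  rw [hX.follower i t ht ω, intervalIntegral.integral_const_mul]
  ring

/-- The total variance of the followers tends to the coherence. -/
theorem tendsto_sum_integral_sq [IsProbabilityMeasure P]
    (hX : IsNoiseFreeLeaderProcess G S P W X) (hG : G.Connected) (hS : S.Nonempty) :
    (∀ i : {i : V // i ∉ S}, ∀ t, 0 ≤ t → Integrable (fun ω => X i t ω ^ 2) P) ∧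
      Tendsto (fun t => ∑ i : {i : V // i ∉ S}, ∫ ω, X i t ω ^ 2 ∂P) atTop
        (𝓝 (coherenceNF G S)) := by
  obtain ⟨U, l, hl, hU1, hU2, hUA, htr⟩ :=
    (hG.posDef_followerLaplacian hS).exists_orthogonal_diagonalization
  have hB := hX.noise.orthogonal hU2
  have hscalar := fun k => hB.tendsto_integral_sq k (hl k) (y := fun t ω => ∑ i, U i k * X i t ω)
    (c := fun ω => ∑ i, U i k * ∑ w ∈ G.neighborFinset i with w ∈ S, X w 0 ω)
    (memLp_finsetSum _ fun i _ => (memLp_finsetSum _ fun w _ => hX.initial w).const_mul _)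
    (memLp_finsetSum _ fun i _ => (hX.initial i).const_mul _)
    (fun ω => continuousOn_finsetSum _ fun i _ => (hX.continuousOn i ω).const_mul _)
    (fun t ht ω => hX.rotated_eq hUA k ht ω)
  have hYint : ∀ k t, 0 ≤ t → Integrable (fun ω => (∑ i, U i k * X i t ω) ^ 2) P :=
    fun k t ht => ((hscalar k).1 t ht).integrable_sq
  have hsum : ∀ t ω, ∑ k, (∑ i, U i k * X i t ω) ^ 2 =
      ∑ i : {i : V // i ∉ S}, X i t ω ^ 2 := fun t ω =>
    Matrix.sum_transpose_mulVec_sq hU1 fun i => X i t ω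
  -- Each `X i t ^ 2` is dominated by the sum of squares of the rotated states, which equals that of
  -- the original ones.
  have hint : ∀ i : {i : V // i ∉ S}, ∀ t, 0 ≤ t → Integrable (fun ω => X i t ω ^ 2) P := by
    intro i t ht
    refine (integrable_finsetSum Finset.univ fun k _ => hYint k t ht).mono'
      ((hX.measurable i t ht).pow_const 2).aestronglyMeasurable (ae_of_all _ fun ω => ?_)
    rw [hsum, Real.norm_of_nonneg (sq_nonneg _)]
    exact Finset.single_le_sum (f := fun i : {i : V // i ∉ S} => X i t ω ^ 2)
      (fun i _ => sq_nonneg _) (Finset.mem_univ i)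
  refine ⟨hint, ?_⟩
  have hlim : coherenceNF G S = ∑ k, 1 / (2 * l k) := by
    rw [coherenceNF, htr, Finset.mul_sum]
    exact Finset.sum_congr rfl fun k _ => by rw [one_div, one_div, mul_inv]
  rw [hlim]
  refine (tendsto_finsetSum _ fun k _ => (hscalar k).2).congr' ?_
  filter_upwards [eventually_ge_atTop 0] with t ht
  rw [← integral_finsetSum _ fun k _ => hYint k t ht,
    ← integral_finsetSum _ fun i _ => hint i t ht]
  simp only [hsum]

end IsNoiseFreeLeaderProcess

end FollowerVariance

theorem mainTheorem7 {V : Type*} [Fintype V] [DecidableEq V]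
    (G : SimpleGraph V) [DecidableRel G.Adj] (r : V) (h : ℕ) (hh : 4 ≤ h)
    (hG : IsPerfectTree 3 G r h) :
    -- The coherence is the total steady-state variance of the followers.
    (∀ S : Finset V, S.Nonempty →
      IsUnit (followerLaplacian G S) ∧
      ∀ (Ω : Type*) [MeasurableSpace Ω] (P : Measure Ω) [IsProbabilityMeasure P]
        (W : {i : V // i ∉ S} → ℝ → Ω → ℝ) (X : V → ℝ → Ω → ℝ),
        IsNoiseFreeLeaderProcess G S P W X →
          (∀ i : {i : V // i ∉ S}, ∀ t, 0 ≤ t → Integrable (fun ω => X i t ω ^ 2) P) ∧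
          Tendsto (fun t => ∑ i : {i : V // i ∉ S}, ∫ ω, X i t ω ^ 2 ∂P) atTop
            (𝓝 (coherenceNF G S))) ∧
    -- The optimal sets of at most two leaders.
    (∀ S : Finset V, IsOptimalLeaderSet G 2 S ↔
      ∃ x y : V, S = {x, y} ∧ G.dist x y = 2 ∧ G.dist x r = 1 ∧ G.dist y r = 1) ∧
    -- The optimal coherence, with `n` the number of nodes; it is attained.
    (∃ S : Finset V, IsOptimalLeaderSet G 2 S) ∧
    (∀ S : Finset V, IsOptimalLeaderSet G 2 S →
      coherenceNF G S =
        (2 * (Fintype.card V : ℝ) + 1) / 4 *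
          (Real.logb 3 (2 * (Fintype.card V : ℝ) + 1) - 2) + 1) := by
  exact ⟨fun S hS => ⟨(hG.isTree.connected.posDef_followerLaplacian hS).isUnit,
      fun _ _ _ _ _ _ hX => hX.tendsto_sum_integral_sq hG.isTree.connected hS⟩,
    hG.isOptimalLeaderSet_iff hh, hG.exists_isOptimalLeaderSet hh,
    fun _ hS => hG.coherenceNF_of_isOptimalLeaderSet hh hS⟩
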